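/- Let $\mathbf M=((M_\sigma)_{\sigma\in\Sigma};\dots)$ be a many-sorted first-order structure with set of sorts $\Sigma$. For $\vec\sigma=(\sigma_1,\dots,\sigma_m)\in\Sigma^m$ put $M_{\vec\sigma}=M_{\sigma_1}\times\cdots\times M_{\sigma_m}$; "definable" means definable in $\mathbf M$ with parameters, "$0$-definable" means definable without parameters. The category $\operatorname{Def}(\mathbf M)$ has as objects the definable sets $X\subseteq M_{\vec\sigma}$ ($\vec\sigma$ being part of the object) and as morphisms the definable maps. For a subset $X\subseteq M_{\vec\sigma}$ and $Y\subseteq M_{\vec\tau}$, $X\times Y$ is viewed as a subset of $M_{\vec\sigma\vec\tau}$. Let $A$ be a commutative semiring. Let $\mathcal D$ be a full subcategory of $\operatorname{Def}(\mathbf M)$ such that (a) if $X,Y\subseteq M_{\vec\sigma}$ are objects of $\mathcal D$, so is $X\cup Y$; (b) definable subsets of objects of $\mathcal D$ are objects of $\mathcal D$; (c) if $X,Y$ are objects of $\mathcal D$, so is $X\times Y$. An $A$-valued Fubini measure on $\mathcal D$ is a function $\mu$ assigning to each object of $\mathcal D$ an element of $A$, such that for all objects $X,Y$ of $\mathcal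 D$: $\mu(\emptyset)=0$, and $\mu(X)=1$ if $X$ is a singleton; $\mu(X\cup Y)=\mu(X)+\mu(Y)$ if $X,Y\subseteq M_{\vec\sigma}$ are disjoint; and for every definable map $f:X\to Y$: (F1) the set $\{\mu(f^{-1}(y)):y\in Y\}$ is finite; (F2) for each $a\in A$ the set $\{y\in Y:\mu(f^{-1}(y))=a\}$ is definable; (F3) if $\mu(f^{-1}(y))=a$ for all $y\in Y$, then $\mu(X)=a\,\mu(Y)$. Let $\Sigma_0\subseteq\Sigma$, and for each $\sigma\in\Sigma_0$ let $C_\sigma\subseteq M_\sigma$ be a nonempty $0$-definable set; assume that some $C_\sigma$ has more than one element. For $\vec\tau\in\Sigma_0^n$ put $C_{\vec\tau}=C_{\tau_1}\times\cdots\times C_{\tau_n}$. Let $\mathcal C$ be the full subcategory of $\operatorname{Def}(\mathbf M)$ whose objects are the definable subsets of the products $C_{\vec\tau}$, $\vec\tau\in\Sigma_0^n$, $n\ge 0$. Assume that $\mathcal C$ is stably embedded in $\mathbf M$: for every $0$-definable $\mathcal S\subseteq M_{\vec\sigma}\times M_{\vec\tau}$ with $\vec\sigma\in\Sigma^m$,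 $\vec\tau\in\Sigma_0^n$, there are $\vec\rho\in\Sigma_0^k$ and a $0$-definable $\mathcal T\subseteq M_{\vec\rho}\times M_{\vec\tau}$ such that for every $p\in M_{\vec\sigma}$ there is $c\in C_{\vec\rho}$ with $\mathcal S(p)\cap C_{\vec\tau}=\mathcal T(c)\cap C_{\vec\tau}$, where $\mathcal S(p)=\{q:(p,q)\in\mathcal S\}$. An $r$-step fibering over $\mathcal C$ of a definable set $X\subseteq M_{\vec\sigma}$ is defined by recursion on $r$ as a tuple of definable maps $(f_1,\dots,f_{r+1})$ together with $\vec\rho_1,\dots,\vec\rho_r$ (tuples of sorts from $\Sigma$) and $\vec\tau_1,\dots,\vec\tau_{r+1}$ (tuples of sorts from $\Sigma_0$), where $f_j$ is a definable map into $M_{\vec\tau_j}$ whose domain is a definable subset of $M_{\vec\rho_1}\times\cdots\times M_{\vec\rho_{j-1}}\times M_{\vec\sigma\vec\tau_1\cdots\vec\tau_{j-1}}$, such that $f_1$ has domain $X$ and takes values in $C_{\vec\tau_1}$, and: if $r=0$, then $f_1$ is injective; if $r\ge1$, then for every $y\in f_1(X)$ there is $x\in M_{\vec\rho_1}$ such that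 $(f_2(x,-),\dots,f_{r+1}(x,-))$, with $\vec\rho_2,\dots,\vec\rho_r$ and $\vec\tau_2,\dots,\vec\tau_{r+1}$, is an $(r-1)$-step fibering over $\mathcal C$ of $f_1^{-1}(y)\times f_1(X)\subseteq M_{\vec\sigma\vec\tau_1}$. A definable set is called fiberable over $\mathcal C$ if it has an $r$-step fibering over $\mathcal C$ for some $r\in\mathbb N$. Let $\mathcal C^{\mathrm f}$ be the full subcategory of $\operatorname{Def}(\mathbf M)$ whose objects are the definable sets that are fiberable over $\mathcal C$. Then $\mathcal C^{\mathrm f}$ satisfies (a), (b), (c) and contains $\mathcal C$, and every $A$-valued Fubini measure on $\mathcal C$ extends uniquely to an $A$-valued Fubini measure on $\mathcal C^{\mathrm f}$. -/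

import Mathlib

/-! Many-sorted first-order structures, definable sets, Fubini measures and fiberable sets. -/

universe u v v' w x

namespace ManySorted


set_option linter.checkUnivs false in
/-- A many-sorted first-order language with set of sorts `S`. -/
structure MSLanguage (S : Type u) where
  /-- function symbols -/
  Func : Type v
  /-- sorts of the arguments of a function symbol -/
  dom : Func → List S
  /-- sort of the value of a function symbol -/
  cod : Func → S
  /-- relation symbols -/
  Rel : Type v'
  /-- sorts of the arguments of a relation symbol -/
  arity : Rel → List S

/-- `Tuple M [σ₁, …, σₘ]` is the product set `M σ₁ × ⋯ × M σₘ` (a point for the empty list). -/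
def Tuple {S : Type u} (M : S → Type w) : List S → Type w
  | [] => PUnit
  | s :: l => M s × Tuple M l

/-- `Var l s` is the type of positions in the list `l` at which the sort is `s`:
the variables of sort `s` in the context `l`. -/
inductive Var {S : Type u} : List S → S → Type u
  | head {s : S} {l : List S} : Var (s :: l) s
  | tail {s t : S} {l : List S} (i : Var l s) : Var (t :: l) s

namespace Tuple

variable {S : Type u} {M : S → Type w}

/-- The coordinate of a tuple at a given position. -/
def get : {l : List S} → {s : S} → Tuple M l → Var l s → M s
  | _, _, a, .head => a.1
  | _, _, a, .tail i => get a.2 i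

/-- The tuple with given coordinates. -/
def ofVar : (l : List S) → (∀ s, Var l s → M s) → Tuple M l
  | [], _ => PUnit.unit
  | s :: l, g => (g s .head, ofVar l (fun t i => g t i.tail))

/-- Concatenation of tuples: the identification of `M_σ × M_τ` with `M_{στ}`. -/
def append : {l l' : List S} → Tuple M l → Tuple M l' → Tuple M (l ++ l')
  | [], _, _, b => b
  | _ :: _, _, a, b => (a.1, append a.2 b)

/-- The product `C_{τ₁} × ⋯ × C_{τₙ}`. -/
def box (C : ∀ s, Set (M s)) : (τ : List S) → Set (Tuple M τ)
  | [] => Set.univ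
  | s :: l => {a | a.1 ∈ C s ∧ a.2 ∈ box C l}

/-- `X × Y` as a subset of `M_{στ}`, for `X ⊆ M_σ` and `Y ⊆ M_τ`. -/
def prod {σ τ : List S} (X : Set (Tuple M σ)) (Y : Set (Tuple M τ)) : Set (Tuple M (σ ++ τ)) :=
  Set.image2 append X Y

end Tuple

section Semantics

variable {S : Type u}

/-- Terms with variables from the context `Γ`, indexed by their sort. -/
inductive Term (L : MSLanguage.{u, v, v'} S) (Γ : List S) : S → Type (max u v)
  | var {s : S} (i : Var Γ s) : Term L Γ s
  | func (f : L.Func) (ts : ∀ s, Var (L.dom f) s → Term L Γ s) : Term L Γ (L.cod f)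

/-- First-order formulas with free variables from the context `Γ`. -/
inductive Formula (L : MSLanguage.{u, v, v'} S) : List S → Type (max u v v')
  | falsum {Γ : List S} : Formula L Γ
  | eq {Γ : List S} {s : S} (t t' : Term L Γ s) : Formula L Γ
  | rel {Γ : List S} (R : L.Rel) (ts : ∀ s, Var (L.arity R) s → Term L Γ s) : Formula L Γ
  | imp {Γ : List S} (φ ψ : Formula L Γ) : Formula L Γ
  | all {Γ : List S} (s : S) (φ : Formula L (s :: Γ)) : Formula L Γ

/-- A many-sorted `L`-structure with underlying sets `M s`, for `s` a sort. -/
class LStructure (L : MSLanguage.{u, v, v'} S) (M : S → Type w) where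
  /-- interpretation of the function symbols -/
  funMap : ∀ f : L.Func, Tuple M (L.dom f) → M (L.cod f)
  /-- interpretation of the relation symbols -/
  relMap : ∀ R : L.Rel, Set (Tuple M (L.arity R))

variable {L : MSLanguage.{u, v, v'} S} {M : S → Type w} [LStructure L M]

/-- The value of a term. -/
def Term.eval {Γ : List S} (a : Tuple M Γ) : {s : S} → Term L Γ s → M s
  | _, .var i => a.get i
  | _, .func f ts => LStructure.funMap f (Tuple.ofVar (L.dom f) (fun s i => (ts s i).eval a))

/-- Truth of a formula. -/
def Formula.Realize : {Γ : List S} → Formula L Γ → Tuple M Γ → Prop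
  | _, .falsum, _ => False
  | _, .eq t t', a => t.eval a = t'.eval a
  | _, .rel R ts, a => Tuple.ofVar (L.arity R) (fun s i => (ts s i).eval a) ∈ LStructure.relMap R
  | _, .imp φ ψ, a => φ.Realize a → ψ.Realize a
  | _, .all s φ, a => ∀ b : M s, φ.Realize ((b, a) : Tuple M (s :: _))

end Semantics

section Definability

variable {S : Type u} (L : MSLanguage.{u, v, v'} S) {M : S → Type w} [LStructure L M]

/-- `X ⊆ M_σ` is `0`-definable, i.e. definable without parameters. -/
def ZeroDefinable {σ : List S} (X : Set (Tuple M σ)) : Prop :=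
  ∃ φ : Formula L σ, ∀ a, a ∈ X ↔ φ.Realize a

/-- `X ⊆ M_σ` is definable with parameters. -/
def Definable {σ : List S} (X : Set (Tuple M σ)) : Prop :=
  ∃ (ρ : List S) (p : Tuple M ρ) (φ : Formula L (ρ ++ σ)), ∀ a, a ∈ X ↔ φ.Realize (p.append a)

/-- The graph of a map `X → Y`, as a subset of `M_{στ}`. -/
def graph {σ τ : List S} {X : Set (Tuple M σ)} {Y : Set (Tuple M τ)} (f : X → Y) :
    Set (Tuple M (σ ++ τ)) :=
  Set.range fun a : X => a.1.append (f a).1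

/-- The fiber `f⁻¹(b)` of a map `X → Y`, as a subset of `M_σ`. -/
def fiber {σ τ : List S} {X : Set (Tuple M σ)} {Y : Set (Tuple M τ)} (f : X → Y) (b : Y) :
    Set (Tuple M σ) :=
  Subtype.val '' (f ⁻¹' {b})

end Definability

/-- A class of objects `X ⊆ M_σ` (with the list of sorts `σ` being part of the object). It stands
for the corresponding full subcategory of the category of definable sets. -/
abbrev SetClass {S : Type u} (M : S → Type w) := ∀ σ : List S, Set (Set (Tuple M σ))

section Fubini

variable {S : Type u} (L : MSLanguage.{u, v, v'} S) {M : S → Type w} [LStructure L M]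

/-- The closure conditions imposed on a full subcategory of the category of definable sets on which
Fubini measures are considered. -/
structure IsClosedClass (𝒞 : SetClass M) : Prop where
  definable : ∀ {σ : List S} {X : Set (Tuple M σ)}, X ∈ 𝒞 σ → Definable L X
  union : ∀ {σ : List S} {X Y : Set (Tuple M σ)}, X ∈ 𝒞 σ → Y ∈ 𝒞 σ → X ∪ Y ∈ 𝒞 σ
  subset : ∀ {σ : List S} {X Y : Set (Tuple M σ)}, X ∈ 𝒞 σ → Y ⊆ X → Definable L Y → Y ∈ 𝒞 σ
  prod : ∀ {σ τ : List S} {X : Set (Tuple M σ)} {Y : Set (Tuple M τ)},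
    X ∈ 𝒞 σ → Y ∈ 𝒞 τ → Tuple.prod X Y ∈ 𝒞 (σ ++ τ)

/-- `μ` is an `A`-valued Fubini measure on `𝒞`. Only the values of `μ` at objects of `𝒞` matter
(when `𝒞` satisfies the closure conditions, all sets to which `μ` is applied below are objects
of `𝒞`). -/
structure IsFubiniMeasure {A : Type x} [CommSemiring A] (𝒞 : SetClass M)
    (μ : ∀ σ : List S, Set (Tuple M σ) → A) : Prop where
  empty : ∀ σ : List S, (∅ : Set (Tuple M σ)) ∈ 𝒞 σ → μ σ ∅ = 0
  singleton : ∀ (σ : List S) (a : Tuple M σ), {a} ∈ 𝒞 σ → μ σ {a} = 1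
  union : ∀ (σ : List S) (X Y : Set (Tuple M σ)), X ∈ 𝒞 σ → Y ∈ 𝒞 σ → Disjoint X Y →
    μ σ (X ∪ Y) = μ σ X + μ σ Y
  finite : ∀ (σ τ : List S) (X : Set (Tuple M σ)) (Y : Set (Tuple M τ)), X ∈ 𝒞 σ → Y ∈ 𝒞 τ →
    ∀ f : X → Y, Definable L (graph f) → (Set.range fun b : Y => μ σ (fiber f b)).Finite
  definable : ∀ (σ τ : List S) (X : Set (Tuple M σ)) (Y : Set (Tuple M τ)), X ∈ 𝒞 σ → Y ∈ 𝒞 τ →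
    ∀ f : X → Y, Definable L (graph f) → ∀ a : A,
      Definable L (Subtype.val '' {b : Y | μ σ (fiber f b) = a})
  fubini : ∀ (σ τ : List S) (X : Set (Tuple M σ)) (Y : Set (Tuple M τ)), X ∈ 𝒞 σ → Y ∈ 𝒞 τ →
    ∀ f : X → Y, Definable L (graph f) → ∀ a : A, (∀ b : Y, μ σ (fiber f b) = a) →
      μ σ X = a * μ τ Y

/-- The class of definable subsets of the products `C_{τ₁} × ⋯ × C_{τₙ}` with `τ₁, …, τₙ ∈ S₀`.
(The sets `C s` with `s ∉ S₀` are irrelevant.) -/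
def defClass (S₀ : Set S) (C : ∀ s, Set (M s)) : SetClass M :=
  fun τ => {X | (∀ s ∈ τ, s ∈ S₀) ∧ X ⊆ Tuple.box C τ ∧ Definable L X}

/-- The class `defClass L S₀ C` is stably embedded. -/
def StablyEmbedded (S₀ : Set S) (C : ∀ s, Set (M s)) : Prop :=
  ∀ (σ τ : List S), (∀ s ∈ τ, s ∈ S₀) → ∀ 𝒮 : Set (Tuple M (σ ++ τ)), ZeroDefinable L 𝒮 →
    ∃ ρ : List S, (∀ s ∈ ρ, s ∈ S₀) ∧ ∃ 𝒯 : Set (Tuple M (ρ ++ τ)), ZeroDefinable L 𝒯 ∧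
      ∀ p : Tuple M σ, ∃ c ∈ Tuple.box C ρ, ∀ b ∈ Tuple.box C τ, p.append b ∈ 𝒮 ↔ c.append b ∈ 𝒯

end Fubini

section Fiberable

variable {S : Type u} (L : MSLanguage.{u, v, v'} S) (M : S → Type w) [LStructure L M]

/-- A definable map `f : X → M_τ` with definable domain `X ⊆ M_π × M_σ`, given by its graph:
`rel p a b` says that `(p, a) ∈ X` and `f (p, a) = b`. It is thought of as the family of maps
`f (p, -)` from subsets of `M_σ` to `M_τ`, with `p ∈ M_π`. -/
structure DefFamily (π σ τ : List S) where
  rel : Tuple M π → Tuple M σ → Tuple M τ → Prop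
  functional : ∀ p a b b', rel p a b → rel p a b' → b = b'
  definable : Definable L
    {z : Tuple M (π ++ (σ ++ τ)) | ∃ p a b, rel p a b ∧ z = p.append (a.append b)}

namespace DefFamily

variable {L M} {π σ τ : List S} (f : DefFamily L M π σ τ) (p : Tuple M π)

/-- The domain of `f (p, -)`. -/
def dom : Set (Tuple M σ) := {a | ∃ b, f.rel p a b}

/-- The image of `f (p, -)`. -/
def range : Set (Tuple M τ) := {b | ∃ a, f.rel p a b}

/-- The fiber of `f (p, -)` over `b`. -/
def fiber (b : Tuple M τ) : Set (Tuple M σ) := {a | f.rel p a b}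

/-- `f (p, -)` is injective. -/
def Inj : Prop := ∀ a a' b, f.rel p a b → f.rel p a' b → a = a'

end DefFamily

/-- The data of an `r`-step fibering of a subset of `M_σ`, depending definably on a parameter
from `M_π`: definable maps `f₁, …, f_{r+1}` where `f_j` is a map into `M_{τ_j}` defined on a subset
of `(M_π × M_{ρ₁} × ⋯ × M_{ρ_{j-1}}) × M_{σ τ₁ ⋯ τ_{j-1}}`, with all `τ_j` lists of sorts from `S₀`
and `ρ_j` arbitrary lists of sorts. -/
inductive FiberingData (S₀ : Set S) : ℕ → List S → List S → Type (max u v v' w)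
  | zero {π σ : List S} (τ : List S) (hτ : ∀ s ∈ τ, s ∈ S₀) (f : DefFamily L M π σ τ) :
      FiberingData S₀ 0 π σ
  | succ {r : ℕ} {π σ : List S} (τ : List S) (hτ : ∀ s ∈ τ, s ∈ S₀) (f : DefFamily L M π σ τ)
      (ρ : List S) (next : FiberingData S₀ r (π ++ ρ) (σ ++ τ)) : FiberingData S₀ (r + 1) π σ

variable {L M}

/-- The data, specialized at the parameter `p`, form an `r`-step fibering of `X`. For `r = 0`: `f₁`
is an injective map `X → C_{τ₁}`. For `r ≥ 1`: `f₁` is a map `X → C_{τ₁}` and for each `b ∈ f₁(X)`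
there is `q ∈ M_{ρ₁}` such that `(f₂(q, -), …, f_{r+1}(q, -))` is an `(r-1)`-step fibering of
`f₁⁻¹(b) × f₁(X)`. -/
def FiberingData.IsFibering {S₀ : Set S} (C : ∀ s, Set (M s)) : {r : ℕ} → {π σ : List S} →
    FiberingData L M S₀ r π σ → Tuple M π → Set (Tuple M σ) → Prop
  | _, _, _, .zero τ _ f, p, X =>
      f.dom p = X ∧ f.range p ⊆ Tuple.box C τ ∧ f.Inj p
  | _, _, _, .succ τ _ f ρ next, p, X =>
      f.dom p = X ∧ f.range p ⊆ Tuple.box C τ ∧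
        ∀ b ∈ f.range p, ∃ q : Tuple M ρ,
          next.IsFibering C (p.append q) (Tuple.prod (f.fiber p b) (f.range p))

variable (L)

/-- `X` is `r`-step fiberable over `defClass L S₀ C`: it has an `r`-step fibering. -/
def StepFiberable (S₀ : Set S) (C : ∀ s, Set (M s)) (r : ℕ) {σ : List S}
    (X : Set (Tuple M σ)) : Prop :=
  ∃ d : FiberingData L M S₀ r [] σ, d.IsFibering C PUnit.unit X

/-- The class of definable sets that are fiberable over `defClass L S₀ C`. -/
def fiberableClass (S₀ : Set S) (C : ∀ s, Set (M s)) : SetClass M :=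
  fun _ => {X | Definable L X ∧ ∃ r : ℕ, StepFiberable L S₀ C r X}

end Fiberable

end ManySorted

open ManySorted

/-! A fibering cuts a set into points in finitely many definable steps, and the values of each step
lie in a product of the sets `C s`. A measure extending `μ` must therefore be an iterated integral
over such products, with the value 1 on points. This forces uniqueness. Existence amounts to showing
that the iterated integral does not depend on the fibering.

Fiberings are first replaced by `Fib`, which describes whole collections of sets. Each stage uses a
single definable family of maps `f (p, -)`, but every set may choose its own `p`.
`mem_fiberableClass_iff` shows that this gives the same fiberable sets. The closure properties then
reduce to pulling back along injections (`Fib.exists_injOn`): the first factor of a product is cut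
before the second, and `X ∪ Y` embeds into `X × Y × C_s` once `C_s` has two points.

Stable embeddedness enters only through `simple_section`: any definable family of subsets of a box
can be coded by points of another box, so its measures take finitely many values, with definable
level sets. Hence integrals of simple functions depend simply on parameters, and the Fubini property
of `μ` allows iterated integrals to be swapped (`integral_swap`).

The extension is built by induction on `Fib`, carrying two properties. `IsIntegrating` says that the
value of a set is the integral of the values of its fibers along every definable map into a box;
`IsUniform` says that values are simple along definable families. The next stage sets `m' X = ∫ m (X
∩ f_p⁻¹(b)) db`. Swapping integrals yields both independence of `p` and `IsIntegrating` for `m'`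
(`StableFubini.exists_step`). Integrating functions agree on common sets
(`Fib.eq_of_isIntegrating`), so the local functions glue to `extension`. Additivity is integration
along a two-valued map, and (F3) follows by cutting the target until it is a point
(`fubini_of_isIntegrating`). Conversely, every Fubini measure extending `μ` is integrating, by
`IsFubiniMeasure.eq_finsum`. -/

namespace ManySorted

/-! ### Tuples, variables and concatenation. -/

section Coordinates

variable {S : Type u} {M : S → Type w}

namespace Tuple

theorem get_ofVar : ∀ {l : List S} (g : ∀ s, Var l s → M s) {s : S} (i : Var l s),
    (ofVar l g).get i = g s i
  | _, _, _, .head => rfl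
  | _, g, _, .tail i => get_ofVar (fun t j => g t j.tail) i

theorem ofVar_get : ∀ {l : List S} (a : Tuple M l), ofVar l (fun _ i => a.get i) = a
  | [], _ => rfl
  | _ :: _, a => Prod.ext rfl (ofVar_get a.2)

/-- The tuple obtained by selecting coordinates along a map of variables. -/
def pull {Γ Δ : List S} (e : ∀ s, Var Γ s → Var Δ s) (b : Tuple M Δ) : Tuple M Γ :=
  ofVar Γ fun s i => b.get (e s i)

theorem pull_id {Γ : List S} (b : Tuple M Γ) : pull (fun _ i => i) b = b := ofVar_get b

theorem pull_pull {Γ Δ Θ : List S} (e : ∀ s, Var Γ s → Var Δ s) (e' : ∀ s, Var Δ s → Var Θ s)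
    (b : Tuple M Θ) : pull e (pull e' b) = pull (fun s i => e' s (e s i)) b := by
  simp [pull, get_ofVar]

end Tuple

namespace Var

/-- Inclusion of the variables of the left part of a context. -/
def inl : {l l' : List S} → {s : S} → Var l s → Var (l ++ l') s
  | _, _, _, .head => .head
  | _, _, _, .tail i => .tail (inl i)

/-- Inclusion of the variables of the right part of a context. -/
def inr : (l : List S) → {l' : List S} → {s : S} → Var l' s → Var (l ++ l') s
  | [], _, _, i => i
  | _ :: l, _, _, i => .tail (inr l i)

/-- Case distinction on the variables of a concatenated context. -/
def elim {V : S → Type*} : {l l' : List S} → (∀ s, Var l s → V s) → (∀ s, Var l' s → V s) →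
    ∀ s, Var (l ++ l') s → V s
  | [], _, _, g, s, i => g s i
  | _ :: _, _, f, _, _, .head => f _ .head
  | _ :: _, _, f, g, s, .tail i => elim (fun t j => f t j.tail) g s i

end Var

namespace Tuple

theorem get_append_inl : ∀ {l l' : List S} (a : Tuple M l) (b : Tuple M l') {s : S} (i : Var l s),
    (a.append b).get i.inl = a.get i
  | _, _, _, _, _, .head => rfl
  | _, _, a, b, _, .tail i => get_append_inl (Prod.snd a) b i

theorem get_append_inr : ∀ {l l' : List S} (a : Tuple M l) (b : Tuple M l') {s : S} (i : Var l' s),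
    (a.append b).get (Var.inr l i) = b.get i
  | [], _, _, _, _, _ => rfl
  | _ :: _, _, a, b, _, i => get_append_inr (Prod.snd a) b i

theorem pull_inl {l l' : List S} (a : Tuple M l) (b : Tuple M l') :
    pull (fun _ i => i.inl) (a.append b) = a := by
  simp only [pull, get_append_inl, ofVar_get]

theorem pull_inr {l l' : List S} (a : Tuple M l) (b : Tuple M l') :
    pull (fun _ i => Var.inr l i) (a.append b) = b := by
  simp only [pull, get_append_inr, ofVar_get]

theorem pull_elim : ∀ {l l' Δ : List S} (e : ∀ s, Var l s → Var Δ s) (e' : ∀ s, Var l' s → Var Δ s)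
    (b : Tuple M Δ), pull (Var.elim e e') b = (pull e b).append (pull e' b)
  | [], _, _, _, _, _ => rfl
  | _ :: _, _, _, e, e', b =>
    Prod.ext rfl (pull_elim (fun t j => e t j.tail) e' b)

theorem append_injective {l l' : List S} {a a' : Tuple M l} {b b' : Tuple M l'}
    (h : a.append b = a'.append b') : a = a' ∧ b = b' := by
  constructor
  · rw [← pull_inl a b, h, pull_inl]
  · rw [← pull_inr a b, h, pull_inr]

theorem append_inj_iff {l l' : List S} {a a' : Tuple M l} {b b' : Tuple M l'} :
    a.append b = a'.append b' ↔ a = a' ∧ b = b' :=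
  ⟨append_injective, fun h => by rw [h.1, h.2]⟩

theorem exists_append {l l' : List S} (z : Tuple M (l ++ l')) :
    ∃ (a : Tuple M l) (b : Tuple M l'), z = a.append b := by
  induction l with
  | nil => exact ⟨PUnit.unit, z, rfl⟩
  | cons s l ih =>
    obtain ⟨a, b, h⟩ := ih z.2
    exact ⟨(z.1, a), b, Prod.ext rfl h⟩

/-- Concatenation of tuples as a bijection. -/
noncomputable def appendEquiv (l l' : List S) : Tuple M l × Tuple M l' ≃ Tuple M (l ++ l') :=
  Equiv.ofBijective (fun x => x.1.append x.2)
    ⟨fun _ _ h => Prod.ext (append_injective h).1 (append_injective h).2, fun z => by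
      obtain ⟨a, b, rfl⟩ := exists_append z
      exact ⟨(a, b), rfl⟩⟩

theorem append_mem_prod {σ τ : List S} {X : Set (Tuple M σ)} {Y : Set (Tuple M τ)}
    {a : Tuple M σ} {b : Tuple M τ} : a.append b ∈ prod X Y ↔ a ∈ X ∧ b ∈ Y := by
  constructor
  · rintro ⟨a', ha, b', hb, h⟩
    obtain ⟨rfl, rfl⟩ := append_injective h
    exact ⟨ha, hb⟩
  · rintro ⟨ha, hb⟩
    exact ⟨a, ha, b, hb, rfl⟩

theorem append_mem_box {C : ∀ s, Set (M s)} : ∀ {σ τ : List S} {a : Tuple M σ} {b : Tuple M τ},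
    a.append b ∈ box C (σ ++ τ) ↔ a ∈ box C σ ∧ b ∈ box C τ
  | [], _, _, _ => by simp [append, box]
  | _ :: _, _, a, b => by
    change _ ∧ append a.2 b ∈ box C _ ↔ (_ ∧ _) ∧ _
    rw [append_mem_box (a := a.2), and_assoc]
    rfl

theorem box_nonempty {S₀ : Set S} {C : ∀ s, Set (M s)} (hC : ∀ s ∈ S₀, (C s).Nonempty) :
    ∀ {τ : List S}, (∀ s ∈ τ, s ∈ S₀) → (box C τ).Nonempty
  | [], _ => ⟨PUnit.unit, trivial⟩
  | s :: l, h => by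
    obtain ⟨a, ha⟩ := hC s (h s (by simp))
    obtain ⟨b, hb⟩ := box_nonempty hC (τ := l) (fun t ht => h t (by simp [ht]))
    exact ⟨(a, b), ha, hb⟩

theorem append_assoc_cast : ∀ {l l' l'' : List S} (a : Tuple M l) (b : Tuple M l') (c : Tuple M l''),
    List.append_assoc l l' l'' ▸ ((a.append b).append c) = a.append (b.append c)
  | [], _, _, _, _, _ => rfl
  | s :: l, l', l'', a, b, c => by
    have key : ∀ {k k' : List S} (h : k = k') (h' : s :: k = s :: k') (x : M s) (t : Tuple M k),
        (h' ▸ ((x, t) : Tuple M (s :: k)) : Tuple M (s :: k')) = (x, h ▸ t) := by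
      rintro k _ rfl _ x t
      rfl
    refine (key (List.append_assoc l l' l'') _ a.1 _).trans ?_
    exact Prod.ext rfl (append_assoc_cast a.2 b c)

end Tuple

end Coordinates

/-! ### Substitution of variables in formulas. -/

section Renaming

variable {S : Type u} {L : MSLanguage.{u, v, v'} S} {M : S → Type w} [LStructure L M]

/-- Renaming of the variables of a term. -/
def Term.rename {Γ Δ : List S} (e : ∀ s, Var Γ s → Var Δ s) : {s : S} → Term L Γ s → Term L Δ s
  | _, .var i => .var (e _ i)
  | _, .func f ts => .func f fun s i => (ts s i).rename e

/-- Extension of a map of variables to a context with one more variable. -/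
def Var.lift {Γ Δ : List S} (e : ∀ s, Var Γ s → Var Δ s) (t : S) :
    ∀ s, Var (t :: Γ) s → Var (t :: Δ) s
  | _, .head => .head
  | _, .tail i => .tail (e _ i)

/-- Renaming of the free variables of a formula. -/
def Formula.rename : {Γ Δ : List S} → (∀ s, Var Γ s → Var Δ s) → Formula L Γ → Formula L Δ
  | _, _, _, .falsum => .falsum
  | _, _, e, .eq t t' => .eq (t.rename e) (t'.rename e)
  | _, _, e, .rel R ts => .rel R fun s i => (ts s i).rename e
  | _, _, e, .imp φ ψ => .imp (φ.rename e) (ψ.rename e)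
  | _, _, e, .all s φ => .all s (φ.rename (Var.lift e s))

theorem Term.eval_rename {Γ Δ : List S} (e : ∀ s, Var Γ s → Var Δ s) (b : Tuple M Δ) {s : S}
    (t : Term L Γ s) : (t.rename e).eval b = t.eval (Tuple.pull e b) := by
  induction t with
  | var i => simp [Term.rename, Term.eval, Tuple.pull, Tuple.get_ofVar]
  | func f ts ih => simp only [Term.rename, Term.eval, ih]

theorem Formula.realize_rename {Γ : List S} (φ : Formula L Γ) :
    ∀ {Δ : List S} (e : ∀ s, Var Γ s → Var Δ s) (b : Tuple M Δ),
      (φ.rename e).Realize b ↔ φ.Realize (Tuple.pull e b) := by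
  induction φ with
  | falsum => intro Δ e b; rfl
  | eq t t' => intro Δ e b; simp only [Formula.rename, Formula.Realize, Term.eval_rename]
  | rel R ts => intro Δ e b; simp only [Formula.rename, Formula.Realize, Term.eval_rename]
  | imp φ ψ h h' => intro Δ e b; simp only [Formula.rename, Formula.Realize, h, h']
  | all s φ h =>
    intro Δ e b
    exact forall_congr' fun c => h _ _

end Renaming

/-! ### A calculus of definable predicates and maps. -/

section Calculus

variable {S : Type u} (L : MSLanguage.{u, v, v'} S) {M : S → Type w} [LStructure L M]

/-- A coordinatization of a type by a product of sorts. -/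
class Coord {S : Type u} (M : outParam (S → Type w)) (T : Type w) where
  /-- the sorts of the coordinates -/
  ctx : List S
  /-- the coordinates -/
  equiv : T ≃ Tuple M ctx

instance Coord.tuple (l : List S) : Coord M (Tuple M l) := ⟨l, Equiv.refl _⟩

noncomputable instance Coord.prod (T U : Type w) [Coord M T] [Coord M U] : Coord M (T × U) :=
  ⟨ctx T ++ ctx U, (Equiv.prodCongr equiv equiv).trans (Tuple.appendEquiv _ _)⟩

/-- Definability with parameters of a predicate on a coordinatized type. -/
def DefPred {T : Type w} [Coord M T] (P : T → Prop) : Prop :=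
  ∃ (ρ : List S) (p : Tuple M ρ) (φ : Formula L (ρ ++ Coord.ctx T)),
    ∀ t, P t ↔ φ.Realize (p.append (Coord.equiv t))

/-- Maps that select coordinates. -/
def IsCoordMap (M : S → Type w) {T U : Type w} [Coord M T] [Coord M U] (g : T → U) : Prop :=
  ∃ e : ∀ s, Var (Coord.ctx U) s → Var (Coord.ctx T) s,
    ∀ t, Coord.equiv (M := M) (g t) = Tuple.pull e (Coord.equiv t)

/-- Maps with definable graph. -/
@[fun_prop]
def DefMap {T U : Type w} [Coord M T] [Coord M U] (g : T → U) : Prop :=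
  DefPred L fun x : T × U => g x.1 = x.2

variable {L} {T U V : Type w} [Coord M T] [Coord M U] [Coord M V]

theorem Coord.equiv_prod (t : T) (u : U) :
    Coord.equiv (M := M) (t, u) = (Coord.equiv t).append (Coord.equiv u) := rfl

namespace IsCoordMap

theorem id : IsCoordMap M (fun t : T => t) :=
  ⟨fun _ i => i, fun _ => (Tuple.pull_id _).symm⟩

theorem fst : IsCoordMap M (Prod.fst : T × U → T) :=
  ⟨fun _ i => i.inl, fun _ => (Tuple.pull_inl _ _).symm⟩

theorem snd : IsCoordMap M (Prod.snd : T × U → U) :=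
  ⟨fun _ i => Var.inr _ i, fun _ => (Tuple.pull_inr _ _).symm⟩

theorem comp {g : U → V} {f : T → U} (hg : IsCoordMap M g) (hf : IsCoordMap M f) :
    IsCoordMap M fun t => g (f t) := by
  obtain ⟨e, he⟩ := hg
  obtain ⟨e', he'⟩ := hf
  exact ⟨fun s i => e' s (e s i), fun t => by rw [he, he', Tuple.pull_pull]⟩

theorem prodMk {g : T → U} {f : T → V} (hg : IsCoordMap M g) (hf : IsCoordMap M f) :
    IsCoordMap M fun t => (g t, f t) := by
  obtain ⟨e, he⟩ := hg
  obtain ⟨e', he'⟩ := hf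
  exact ⟨Var.elim e e', fun t => by rw [Coord.equiv_prod, he, he']; exact (Tuple.pull_elim _ _ _).symm⟩

end IsCoordMap

namespace DefPred

theorem congr {P Q : T → Prop} (hP : DefPred L P) (h : ∀ t, Q t ↔ P t) : DefPred L Q := by
  rwa [show Q = P from funext fun t => propext (h t)]

/-- Selecting coordinates only renames variables, so no quantifier is needed. Composition with
arbitrary definable maps is later derived from this by quantifying over the graph. -/
theorem compCoord {P : U → Prop} (hP : DefPred L P) {g : T → U} (hg : IsCoordMap M g) :
    DefPred L fun t => P (g t) := by
  obtain ⟨ρ, p, φ, h⟩ := hP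
  obtain ⟨e, he⟩ := hg
  refine ⟨ρ, p, φ.rename (Var.elim (fun _ i => i.inl) fun s i => Var.inr ρ (e s i)), fun t => ?_⟩
  refine (h _).trans ?_
  rw [Formula.realize_rename, Tuple.pull_elim, Tuple.pull_inl, he,
    ← Tuple.pull_pull e (fun _ i => Var.inr ρ i), Tuple.pull_inr]

theorem imp {P Q : T → Prop} (hP : DefPred L P) (hQ : DefPred L Q) :
    DefPred L fun t => P t → Q t := by
  obtain ⟨ρ, p, φ, h⟩ := hP
  obtain ⟨ρ', p', φ', h'⟩ := hQ
  refine ⟨ρ ++ ρ', p.append p', .imp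
    (φ.rename (Var.elim (fun _ i => i.inl.inl) fun _ i => Var.inr _ i))
    (φ'.rename (Var.elim (fun _ i => (Var.inr ρ i).inl) fun _ i => Var.inr _ i)), fun t => ?_⟩
  simp only [Formula.Realize, Formula.realize_rename]
  rw [h, h', Tuple.pull_elim, Tuple.pull_elim, Tuple.pull_inr,
    ← Tuple.pull_pull (fun _ i => i.inl) (fun _ i => i.inl),
    ← Tuple.pull_pull (fun _ i => Var.inr ρ i) (fun _ i => i.inl), Tuple.pull_inl,
    Tuple.pull_inl, Tuple.pull_inr]

theorem false : DefPred L fun _ : T => False :=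
  ⟨[], PUnit.unit, .falsum, fun _ => Iff.rfl⟩

theorem not {P : T → Prop} (hP : DefPred L P) : DefPred L fun t => ¬ P t := hP.imp false

theorem true : DefPred L fun _ : T => True := false.not.congr (by simp)

theorem const (P : Prop) : DefPred L fun _ : T => P := by
  by_cases h : P
  · exact true.congr (by simp [h])
  · exact false.congr (by simp [h])

theorem and {P Q : T → Prop} (hP : DefPred L P) (hQ : DefPred L Q) :
    DefPred L fun t => P t ∧ Q t := (hP.imp hQ.not).not.congr (by simp)

theorem or {P Q : T → Prop} (hP : DefPred L P) (hQ : DefPred L Q) :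
    DefPred L fun t => P t ∨ Q t := (hP.not.imp hQ).congr fun t => by tauto

theorem iff {P Q : T → Prop} (hP : DefPred L P) (hQ : DefPred L Q) :
    DefPred L fun t => (P t ↔ Q t) := ((hP.imp hQ).and (hQ.imp hP)).congr fun t => by tauto

theorem finset_or {ι : Type*} (s : Finset ι) {P : ι → T → Prop} (hP : ∀ i, DefPred L (P i)) :
    DefPred L fun t => ∃ i ∈ s, P i t := by
  classical
  induction s using Finset.induction_on with
  | empty => exact false.congr (by simp)
  | insert i s _ ih => exact ((hP i).or ih).congr (by simp)

theorem all_head {s : S} {l : List S} {P : Tuple M (s :: l) → Prop} (hP : DefPred L P) :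
    DefPred L fun a : Tuple M l => ∀ b : M s, P (b, a) := by
  obtain ⟨ρ, p, φ, h⟩ := hP
  refine ⟨ρ, p, .all s (φ.rename (Var.elim (l := ρ) (l' := s :: l) (fun _ i => .tail i.inl)
    (Var.lift (fun _ i => Var.inr ρ i) s))), fun a => ?_⟩
  refine forall_congr' fun b => ?_
  refine (h _).trans (Iff.trans ?_ (Formula.realize_rename _ _ _).symm)
  have h1 : Tuple.pull (fun _ i => (.tail i.inl : Var (s :: (ρ ++ l)) _))
      ((b, p.append a) : Tuple M (s :: (ρ ++ l))) = p := Tuple.pull_inl p a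
  have h2 : Tuple.pull (Var.lift (fun _ i => Var.inr ρ i) s)
      ((b, p.append a) : Tuple M (s :: (ρ ++ l))) = ((b, a) : Tuple M (s :: l)) :=
    Prod.ext rfl (Tuple.pull_inr p a)
  erw [Tuple.pull_elim, h1, h2]
  rfl

theorem all_append : ∀ {l l' : List S} {P : Tuple M (l ++ l') → Prop} (_ : DefPred L P),
      DefPred L fun a : Tuple M l' => ∀ b : Tuple M l, P (b.append a)
  | [], _, _, hP => hP.congr fun _ => ⟨fun h => h PUnit.unit, fun h _ => h⟩
  | _ :: _, _, _, hP => (all_append (all_head hP)).congr fun _ =>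
      ⟨fun h b c => h (c, b), fun h b => h b.2 b.1⟩

theorem all {P : T → U → Prop} (hP : DefPred L fun x : T × U => P x.1 x.2) :
    DefPred L fun t => ∀ u, P t u := by
  -- `all_append` binds the left block of variables, so the two factors are exchanged first.
  have h := hP.compCoord (IsCoordMap.prodMk (IsCoordMap.snd (M := M) (T := U) (U := T)) IsCoordMap.fst)
  obtain ⟨ρ, p, φ, h⟩ := h
  have h' : DefPred L fun a : Tuple M (Coord.ctx U ++ Coord.ctx T) =>
    φ.Realize (p.append a) := ⟨ρ, p, φ, fun _ => Iff.rfl⟩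
  obtain ⟨ρ', p', φ', h''⟩ := all_append h'
  refine ⟨ρ', p', φ', fun t => ?_⟩
  refine Iff.trans ?_ (h'' (Coord.equiv t))
  refine ⟨fun H b => ?_, fun H u => (h (u, t)).2 (H _)⟩
  have := (h (Coord.equiv.symm b, t)).1 (H _)
  rwa [Coord.equiv_prod, Equiv.apply_symm_apply] at this

theorem ex {P : T → U → Prop} (hP : DefPred L fun x : T × U => P x.1 x.2) :
    DefPred L fun t => ∃ u, P t u :=
  (all (P := fun t u => ¬ P t u) hP.not).not.congr (by simp)

/-- The fixed point joins the tuple of parameters. -/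
theorem fix {P : T × U → Prop} (hP : DefPred L P) (t : T) : DefPred L fun u => P (t, u) := by
  obtain ⟨ρ, p, φ, h⟩ := hP
  refine ⟨ρ ++ Coord.ctx T, p.append (Coord.equiv t), φ.rename (Var.elim (fun _ i => i.inl.inl)
    (Var.elim (fun _ i => (Var.inr ρ i).inl) fun _ i => Var.inr _ i)), fun u => ?_⟩
  refine (h _).trans ?_
  rw [Formula.realize_rename, Tuple.pull_elim,
    ← Tuple.pull_pull (fun _ i => i.inl) (fun _ i => i.inl)]
  erw [Tuple.pull_elim]
  rw [← Tuple.pull_pull (fun _ i => Var.inr ρ i) (fun _ i => i.inl), Tuple.pull_inl,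
    Tuple.pull_inl, Tuple.pull_inr, Tuple.pull_inr]
  rfl

theorem eq_pull : ∀ {l Δ : List S} (e e' : ∀ s, Var l s → Var Δ s),
    DefPred L fun a : Tuple M Δ => Tuple.pull e a = Tuple.pull e' a
  | [], _, _, _ => true.congr fun _ => iff_true_intro rfl
  | s :: l, _, e, e' => by
    refine DefPred.congr (DefPred.and (P := fun a => a.get (e s .head) = a.get (e' s .head))
      ⟨[], PUnit.unit, .eq (.var (e s .head)) (.var (e' s .head)), fun _ => Iff.rfl⟩
      (eq_pull (fun s i => e s i.tail) (fun s i => e' s i.tail))) fun a => Prod.ext_iff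

theorem eqCoord {f g : T → U} (hf : IsCoordMap M f) (hg : IsCoordMap M g) :
    DefPred L fun t => f t = g t := by
  obtain ⟨e, he⟩ := hf
  obtain ⟨e', he'⟩ := hg
  obtain ⟨ρ, p, φ, h⟩ := eq_pull (L := L) (M := M) e e'
  refine ⟨ρ, p, φ, fun t => Iff.trans ?_ (h (Coord.equiv t))⟩
  change f t = g t ↔ Tuple.pull e (Coord.equiv t) = Tuple.pull e' (Coord.equiv t)
  rw [← he, ← he', Equiv.apply_eq_iff_eq]

theorem comp {P : U → Prop} (hP : DefPred L P) {g : T → U} (hg : DefMap L g) :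
    DefPred L fun t => P (g t) :=
  (ex (P := fun t u => g t = u ∧ P u) (DefPred.and hg (hP.compCoord .snd))).congr (by simp)

end DefPred

theorem IsCoordMap.defMap {f : T → U} (hf : IsCoordMap M f) : DefMap L f :=
  DefPred.eqCoord (hf.comp .fst) .snd

namespace DefMap

@[fun_prop] theorem id : DefMap L (fun t : T => t) := IsCoordMap.id.defMap

theorem fst : DefMap L (Prod.fst : T × U → T) := IsCoordMap.fst.defMap

theorem snd : DefMap L (Prod.snd : T × U → U) := IsCoordMap.snd.defMap

@[fun_prop] theorem const (u : U) : DefMap L (fun _ : T => u) :=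
  ((DefPred.eqCoord (M := M) (L := L) (IsCoordMap.fst (T := U) (U := U)) .snd).fix u).compCoord .snd

@[fun_prop] theorem comp {g : U → V} {f : T → U} (hg : DefMap L g) (hf : DefMap L f) :
    DefMap L fun t => g (f t) := by
  have h1 : DefPred L fun y : (T × V) × U => f y.1.1 = y.2 := 
    DefPred.compCoord (P := fun x : T × U => f x.1 = x.2) hf
      (.prodMk (IsCoordMap.fst.comp .fst) .snd)
  have h2 : DefPred L fun y : (T × V) × U => g y.2 = y.1.2 := 
    DefPred.compCoord (P := fun x : U × V => g x.1 = x.2) hg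
      (.prodMk .snd (IsCoordMap.snd.comp .fst))
  exact (DefPred.ex (P := fun (x : T × V) u => f x.1 = u ∧ g u = x.2) (h1.and h2)).congr (by simp)

@[fun_prop] theorem fst' {f : T → U × V} (hf : DefMap L f) : DefMap L fun t => (f t).1 :=
  comp fst hf

@[fun_prop] theorem snd' {f : T → U × V} (hf : DefMap L f) : DefMap L fun t => (f t).2 :=
  comp snd hf

@[fun_prop] theorem prodMk {f : T → U} {g : T → V} (hf : DefMap L f) (hg : DefMap L g) :
    DefMap L fun t => (f t, g t) := by
  have h1 : DefPred L fun y : T × (U × V) => f y.1 = y.2.1 :=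
    DefPred.compCoord (P := fun x : T × U => f x.1 = x.2) hf
      (.prodMk .fst (IsCoordMap.fst.comp .snd))
  have h2 : DefPred L fun y : T × (U × V) => g y.1 = y.2.2 :=
    DefPred.compCoord (P := fun x : T × V => g x.1 = x.2) hg
      (.prodMk .fst (IsCoordMap.snd.comp .snd))
  exact (h1.and h2).congr fun y => Prod.ext_iff

@[fun_prop] theorem append {l l' : List S} {f : T → Tuple M l} {g : T → Tuple M l'}
    (hf : DefMap L f) (hg : DefMap L g) : DefMap L fun t => (f t).append (g t) := by
  have h : IsCoordMap M fun x : Tuple M l × Tuple M l' => x.1.append x.2 :=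
    ⟨fun _ i => i, fun _ => (Tuple.pull_id _).symm⟩
  exact comp h.defMap (prodMk hf hg)

end DefMap

theorem DefPred.eq {f g : T → U} (hf : DefMap L f) (hg : DefMap L g) :
    DefPred L fun t => f t = g t :=
  DefPred.comp (P := fun x : U × U => x.1 = x.2) (DefPred.eqCoord .fst .snd)
    (DefMap.prodMk hf hg)

theorem DefMap.ite {f g : T → U} {P : T → Prop} [DecidablePred P] (hP : DefPred L P)
    (hf : DefMap L f) (hg : DefMap L g) : DefMap L fun t => if P t then f t else g t := by
  refine DefPred.congr (((hP.comp DefMap.fst).and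
      (DefPred.eq (f := fun x : T × U => f x.1) (g := fun x => x.2) (by fun_prop) (by fun_prop))).or
    ((hP.comp DefMap.fst).not.and (DefPred.eq (f := fun x : T × U => g x.1) (g := fun x => x.2)
      (by fun_prop) (by fun_prop)))) fun x => ?_
  by_cases h : P x.1 <;> simp [h]

theorem definable_iff_defPred {σ : List S} {X : Set (Tuple M σ)} :
    Definable L X ↔ DefPred L fun a => a ∈ X := Iff.rfl

theorem ZeroDefinable.definable {σ : List S} {X : Set (Tuple M σ)} (hX : ZeroDefinable L X) :
    Definable L X := by
  obtain ⟨φ, h⟩ := hX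
  exact ⟨[], PUnit.unit, φ, h⟩

theorem definable_append_iff {σ τ : List S} {R : Tuple M σ → Tuple M τ → Prop} :
    Definable L {z : Tuple M (σ ++ τ) | ∃ a b, R a b ∧ z = a.append b} ↔
      DefPred L fun x : Tuple M σ × Tuple M τ => R x.1 x.2 := by
  constructor
  · intro h
    refine (DefPred.comp (definable_iff_defPred.1 h)
      (g := fun x : Tuple M σ × Tuple M τ => x.1.append x.2) (by fun_prop)).congr fun x => ?_
    constructor
    · exact fun hx => ⟨_, _, hx, rfl⟩
    · rintro ⟨a, b, hx, e⟩
      obtain ⟨h1, h2⟩ := Tuple.append_injective e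
      rwa [h1, h2]
  · rintro ⟨ρ, p, φ, h⟩
    refine ⟨ρ, p, φ, fun z => ?_⟩
    obtain ⟨a, b, rfl⟩ := Tuple.exists_append z
    refine Iff.trans ?_ (h (a, b))
    constructor
    · rintro ⟨a', b', hx, e⟩
      obtain ⟨rfl, rfl⟩ := Tuple.append_injective e
      exact hx
    · exact fun hx => ⟨_, _, hx, rfl⟩

theorem defPred_box {S₀ : Set S} {C : ∀ s, Set (M s)}
    (hC : ∀ s ∈ S₀, ZeroDefinable L {a : Tuple M [s] | a.1 ∈ C s}) :
    ∀ {τ : List S}, (∀ s ∈ τ, s ∈ S₀) → DefPred L fun a : Tuple M τ => a ∈ Tuple.box C τ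
  | [], _ => DefPred.true.congr fun _ => by simp [Tuple.box]
  | s :: l, h => by
    have h1 := definable_iff_defPred.1 (hC s (h s (by simp))).definable
    have h2 := defPred_box hC (τ := l) fun t ht => h t (by simp [ht])
    refine (DefPred.and (h1.compCoord (g := fun a : Tuple M (s :: l) =>
      ((a.1, PUnit.unit) : Tuple M [s])) ⟨?_, ?_⟩)
      (h2.compCoord (g := fun a : Tuple M (s :: l) => a.2) ⟨fun _ i => i.tail, ?_⟩)).congr
      fun a => Iff.rfl
    · exact fun _ i => i.inl (l := [s]) (l' := l)
    · exact fun a => rfl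
    · exact fun a => (Tuple.ofVar_get _).symm

end Calculus

/-! ### Definable families of sets. -/

section Families

variable {S : Type u} (L : MSLanguage.{u, v, v'} S) {M : S → Type w} [LStructure L M]
variable {T U V : Type w} [Coord M T] [Coord M U] [Coord M V]

/-- Definable families of sets. -/
def DefFam (Z : T → Set U) : Prop := DefPred L fun x : T × U => x.2 ∈ Z x.1

variable {L}

theorem DefFam.mem {Z : T → Set U} (hZ : DefFam L Z) {f : V → T} {g : V → U} (hf : DefMap L f)
    (hg : DefMap L g) : DefPred L fun v => g v ∈ Z (f v) :=
  DefPred.comp (P := fun x : T × U => x.2 ∈ Z x.1) hZ (hf.prodMk hg)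

theorem DefFam.comp {Z : T → Set U} (hZ : DefFam L Z) {f : V → T} (hf : DefMap L f) :
    DefFam L fun v => Z (f v) :=
  hZ.mem (hf.comp DefMap.fst) DefMap.snd

theorem DefFam.inter {Z Z' : T → Set U} (hZ : DefFam L Z) (hZ' : DefFam L Z') :
    DefFam L fun t => Z t ∩ Z' t := DefPred.and hZ hZ'

theorem DefFam.const {X : Set U} (hX : DefPred L fun a => a ∈ X) : DefFam L fun _ : T => X :=
  hX.comp DefMap.snd

theorem DefFam.apply {Z : T → Set U} (hZ : DefFam L Z) (t : T) : DefPred L fun a => a ∈ Z t :=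
  DefPred.fix (P := fun x : T × U => x.2 ∈ Z x.1) hZ t

theorem DefFam.preimage {f : T × U → V} (hf : DefMap L f) :
    DefFam L fun x : T × V => {a : U | f (x.1, a) = x.2} :=
  DefPred.eq (f := fun x : (T × V) × U => f (x.1.1, x.2)) (g := fun x => x.1.2)
    (by fun_prop) (by fun_prop)

theorem DefFam.apply_defPred {σ : List S} {Z : T → Set (Tuple M σ)} (hZ : DefFam L Z) (t : T) :
    Definable L (Z t) := hZ.apply t

theorem Coord.defMap_symm : DefMap L (Coord.equiv.symm : Tuple M (Coord.ctx T) → T) :=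
  IsCoordMap.defMap ⟨fun _ i => i, fun t => (Equiv.apply_symm_apply _ t).trans (Tuple.pull_id _).symm⟩

end Families

/-! ### Uniform decompositions into subsingletons and their closure properties. -/

section Fib

variable {S : Type u} (L : MSLanguage.{u, v, v'} S) {M : S → Type w} [LStructure L M]
variable (S₀ : Set S) (C : ∀ s, Set (M s))

/-- Collections of sets that are decomposed, in a fixed number of steps and uniformly, into
subsingletons by definable maps into products of the sets `C s`. -/
inductive Fib : {σ : List S} → Set (Set (Tuple M σ)) → Prop
  | base {σ : List S} : Fib {X : Set (Tuple M σ) | X.Subsingleton}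
  | step {π σ τ : List S} (hπ : Nonempty (Tuple M π)) (hτ : ∀ s ∈ τ, s ∈ S₀)
      (f : Tuple M π × Tuple M σ → Tuple M τ) (hf : DefMap L f) (hfC : ∀ z, f z ∈ Tuple.box C τ)
      {𝒴 : Set (Set (Tuple M σ))} (h : Fib 𝒴) :
      Fib {X : Set (Tuple M σ) | ∃ p, ∀ b, X ∩ {a | f (p, a) = b} ∈ 𝒴}

variable {L S₀ C}

namespace Fib

/-- Some parameter must be available for the empty set; this is why `Fib.step` asks for a nonempty
parameter space. -/
theorem empty_mem {σ : List S} {𝒳 : Set (Set (Tuple M σ))} (h : Fib L S₀ C 𝒳) : ∅ ∈ 𝒳 := by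
  induction h with
  | base => exact Set.subsingleton_empty
  | step hπ hτ f hf hfC h ih =>
    obtain ⟨p⟩ := hπ
    exact ⟨p, fun b => by rwa [Set.empty_inter]⟩

theorem mono {σ : List S} {𝒳 : Set (Set (Tuple M σ))} (h : Fib L S₀ C 𝒳) :
    ∀ {X Y : Set (Tuple M σ)}, X ∈ 𝒳 → Y ⊆ X → Y ∈ 𝒳 := by
  induction h with
  | base => exact fun hX hY => Set.Subsingleton.anti hX hY
  | step hπ hτ f hf hfC h ih =>
    rintro X Y ⟨p, hp⟩ hY
    exact ⟨p, fun b => ih (hp b) (Set.inter_subset_inter_left _ hY)⟩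

/-- The number of stages is fixed and each stage only adds the quantifiers "some `p`, all `b`", so
membership is a first-order condition. This is what later makes the level sets of the extended
measure definable. -/
theorem defPred_mem {σ : List S} {𝒳 : Set (Set (Tuple M σ))} (h : Fib L S₀ C 𝒳) :
    ∀ {T : Type w} [Coord M T] {Z : T → Set (Tuple M σ)}, DefFam L Z →
      DefPred L fun t => Z t ∈ 𝒳 := by
  induction h with
  | @base σ =>
    intro T _ Z hZ
    refine DefPred.congr (.all (P := fun t (a : Tuple M σ) => ∀ a', a ∈ Z t → a' ∈ Z t → a = a') (.all ?_))
      fun t => ⟨fun h a a' ha ha' => h ha ha', fun h a ha a' ha' => h a a' ha ha'⟩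
    exact .imp (hZ.mem (by fun_prop) (by fun_prop)) (.imp (hZ.mem (by fun_prop) (by fun_prop))
      (.eq (by fun_prop) (by fun_prop)))
  | step hπ hτ f hf hfC h ih =>
    intro T _ Z hZ
    refine .ex (.all (ih ?_))
    exact (hZ.comp (f := fun z : (T × Tuple M _) × Tuple M _ => z.1.1) (by fun_prop)).inter
      ((DefFam.preimage hf).comp (f := fun z : (T × Tuple M _) × Tuple M _ => (z.1.2, z.2))
        (by fun_prop))

/-- A flexible form of `Fib.step`: the maps may be partial, the parameters may range over any
coordinatized type, and only nonempty fibers are tested. -/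
theorem exists_step (hC : ∀ s ∈ S₀, (C s).Nonempty)
    (hCd : ∀ s ∈ S₀, ZeroDefinable L {a : Tuple M [s] | a.1 ∈ C s})
    {T : Type w} [Coord M T] {σ τ : List S} (hτ : ∀ s ∈ τ, s ∈ S₀)
    {R : T → Tuple M σ → Tuple M τ → Prop}
    (hR : DefPred L fun x : (T × Tuple M σ) × Tuple M τ => R x.1.1 x.1.2 x.2)
    (hfun : ∀ t a b b', R t a b → R t a b' → b = b')
    {𝒴 : Set (Set (Tuple M σ))} (h𝒴 : Fib L S₀ C 𝒴) {𝒳₀ : Set (Set (Tuple M σ))}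
    (h𝒳₀ : ∀ X ∈ 𝒳₀, ∃ t, ∀ a ∈ X, ∃ b ∈ Tuple.box C τ, R t a b ∧ {a' ∈ X | R t a' b} ∈ 𝒴) :
    ∃ 𝒳, Fib L S₀ C 𝒳 ∧ 𝒳₀ ⊆ 𝒳 := by
  classical
  -- If there are no parameters, the hypothesis leaves no sets in `𝒳₀`.
  by_cases hT : Nonempty T
  swap
  · exact ⟨_, .base, fun X hX => (hT ⟨(h𝒳₀ X hX).choose⟩).elim⟩
  have hπ : Nonempty (Tuple M (Coord.ctx T)) := hT.map Coord.equiv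
  obtain ⟨c, hc⟩ := Tuple.box_nonempty hC hτ
  let R' : Tuple M (Coord.ctx T) × Tuple M σ → Tuple M τ → Prop := fun z b =>
    b ∈ Tuple.box C τ ∧ R (Coord.equiv.symm z.1) z.2 b
  have hR' : DefPred L fun x : (Tuple M (Coord.ctx T) × Tuple M σ) × Tuple M τ => R' x.1 x.2 := by
    refine .and ((defPred_box hCd hτ).comp (by fun_prop)) ?_
    have := Coord.defMap_symm (L := L) (T := T)
    exact DefPred.comp (P := fun x : (T × Tuple M σ) × Tuple M τ => R x.1.1 x.1.2 x.2) hR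
      (g := fun x : (Tuple M (Coord.ctx T) × Tuple M σ) × Tuple M τ =>
        ((Coord.equiv.symm x.1.1, x.1.2), x.2)) (by fun_prop)
  -- The partial map is made total with the arbitrary value `c` of the box. This is harmless: on the
  -- sets in question `R` already has a value in the box, so the default is never used there.
  let f : Tuple M (Coord.ctx T) × Tuple M σ → Tuple M τ := fun z =>
    if h : ∃ b, R' z b then h.choose else c
  have hf_pos : ∀ z b, R' z b → f z = b := by
    intro z b hb
    have h : ∃ b, R' z b := ⟨b, hb⟩
    simp only [f, dif_pos h]
    exact hfun _ _ _ _ h.choose_spec.2 hb.2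
  have hf_neg : ∀ z, (¬ ∃ b, R' z b) → f z = c := fun z h => by simp only [f, dif_neg h]
  have hfC : ∀ z, f z ∈ Tuple.box C τ := by
    intro z
    by_cases h : ∃ b, R' z b
    · obtain ⟨b, hb⟩ := h
      rw [hf_pos z b hb]
      exact hb.1
    · rwa [hf_neg z h]
  have hf : DefMap L f := by
    refine DefPred.congr (P := fun x => R' x.1 x.2 ∨ ((¬ ∃ b, R' x.1 b) ∧ x.2 = c)) ?_ ?_
    · refine .or hR' (.and (.not (.ex ?_)) (.eq (by fun_prop) (by fun_prop)))
      exact DefPred.comp (P := fun x : (Tuple M (Coord.ctx T) × Tuple M σ) × Tuple M τ => R' x.1 x.2)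
        hR' (g := fun x : ((Tuple M (Coord.ctx T) × Tuple M σ) × Tuple M τ) × Tuple M τ =>
          (x.1.1, x.2)) (by fun_prop)
    · rintro ⟨z, b⟩
      change f z = b ↔ R' z b ∨ (¬ ∃ b, R' z b) ∧ b = c
      constructor
      · rintro rfl
        by_cases h : ∃ b, R' z b
        · obtain ⟨b, hb⟩ := h
          left
          rwa [hf_pos z b hb]
        · exact Or.inr ⟨h, hf_neg z h⟩
      · rintro (h | ⟨h, h'⟩)
        · exact hf_pos z b h
        · exact (hf_neg z h).trans h'.symm
  refine ⟨_, .step hπ hτ f hf hfC h𝒴, fun X hX => ?_⟩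
  obtain ⟨t, ht⟩ := h𝒳₀ X hX
  refine ⟨Coord.equiv t, fun b => ?_⟩
  have key : ∀ a ∈ X, ∀ b', f (Coord.equiv t, a) = b' → R t a b' := by
    rintro a ha _ rfl
    obtain ⟨b, hb, hRb, -⟩ := ht a ha
    have : R' (Coord.equiv t, a) b := ⟨hb, by simpa using hRb⟩
    rwa [hf_pos _ _ this]
  rcases (X ∩ {a | f (Coord.equiv t, a) = b}).eq_empty_or_nonempty with h | ⟨a, ha, hab⟩
  · rw [h]
    exact h𝒴.empty_mem
  · obtain ⟨b', hb', hRb, hY⟩ := ht a ha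
    obtain rfl := hfun _ _ _ _ hRb (key a ha b hab)
    exact h𝒴.mono hY fun a' ha' => ⟨ha'.1, key a' ha'.1 _ ha'.2⟩

theorem exists_step_map (hC : ∀ s ∈ S₀, (C s).Nonempty)
    (hCd : ∀ s ∈ S₀, ZeroDefinable L {a : Tuple M [s] | a.1 ∈ C s})
    {T : Type w} [Coord M T] {σ τ : List S} (hτ : ∀ s ∈ τ, s ∈ S₀)
    {f : T × Tuple M σ → Tuple M τ} (hf : DefMap L f)
    {𝒴 : Set (Set (Tuple M σ))} (h𝒴 : Fib L S₀ C 𝒴) {𝒳₀ : Set (Set (Tuple M σ))}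
    (h𝒳₀ : ∀ X ∈ 𝒳₀, ∃ t, ∀ a ∈ X, f (t, a) ∈ Tuple.box C τ ∧
      {a' ∈ X | f (t, a') = f (t, a)} ∈ 𝒴) :
    ∃ 𝒳, Fib L S₀ C 𝒳 ∧ 𝒳₀ ⊆ 𝒳 :=
  exists_step hC hCd hτ (R := fun t a b => f (t, a) = b)
    (.eq (by fun_prop) (by fun_prop)) (fun _ _ _ _ h h' => h.symm.trans h') h𝒴
    fun X hX => (h𝒳₀ X hX).imp fun _ ht a ha => ⟨_, (ht a ha).1, rfl, (ht a ha).2⟩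

/-- A decomposition of the target pulls back: compose each stage with `g`, and remember `t` together
with the stage's own parameter. At the end an injection into a subsingleton has a subsingleton
domain. -/
theorem exists_injOn (hC : ∀ s ∈ S₀, (C s).Nonempty)
    (hCd : ∀ s ∈ S₀, ZeroDefinable L {a : Tuple M [s] | a.1 ∈ C s})
    {σ : List S} {𝒴 : Set (Set (Tuple M σ))} (h𝒴 : Fib L S₀ C 𝒴) :
    ∀ {T : Type w} [Coord M T] {ξ : List S} {g : T × Tuple M ξ → Tuple M σ} (_ : DefMap L g),
    ∃ 𝒳, Fib L S₀ C 𝒳 ∧ {X | ∃ t, ∃ Y ∈ 𝒴, (∀ a ∈ X, g (t, a) ∈ Y) ∧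
      Set.InjOn (fun a => g (t, a)) X} ⊆ 𝒳 := by
  induction h𝒴 with
  | base =>
    intro T _ ξ g hg
    refine ⟨_, .base, ?_⟩
    rintro X ⟨t, Y, hY, hXY, hinj⟩ a ha a' ha'
    exact hinj ha ha' (hY (hXY a ha) (hXY a' ha'))
  | @step π σ τ hπ hτ f hf hfC 𝒴 h ih =>
    intro T _ ξ g hg
    obtain ⟨𝒳, h𝒳, hsub⟩ := ih hg
    refine exists_step_map hC hCd hτ (T := T × Tuple M π)
      (f := fun z => f (z.1.2, g (z.1.1, z.2))) (by fun_prop) h𝒳 ?_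
    rintro X ⟨t, Y, ⟨p, hp⟩, hXY, hinj⟩
    refine ⟨(t, p), fun a ha => ⟨hfC _, hsub ⟨t, _, hp (f (p, g (t, a))), ?_, ?_⟩⟩⟩
    · exact fun a' ha' => ⟨hXY a' ha'.1, ha'.2⟩
    · exact hinj.mono fun a' ha' => ha'.1

/-- The first factor is decomposed first. Once it is a subsingleton, the second projection is
injective and the decomposition of the second factor takes over. -/
theorem exists_prod (hC : ∀ s ∈ S₀, (C s).Nonempty)
    (hCd : ∀ s ∈ S₀, ZeroDefinable L {a : Tuple M [s] | a.1 ∈ C s})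
    {σ : List S} {𝒳 : Set (Set (Tuple M σ))} (h𝒳 : Fib L S₀ C 𝒳)
    {τ : List S} {𝒴 : Set (Set (Tuple M τ))} (h𝒴 : Fib L S₀ C 𝒴) :
    ∃ 𝒵, Fib L S₀ C 𝒵 ∧ {Z | ∃ X ∈ 𝒳, ∃ Y ∈ 𝒴, Z ⊆ Tuple.prod X Y} ⊆ 𝒵 := by
  have hr : DefMap L (fun z : Tuple M (σ ++ τ) => (Tuple.appendEquiv σ τ).symm z) :=
    DefPred.congr (DefPred.eq (f := fun x : Tuple M (σ ++ τ) × (Tuple M σ × Tuple M τ) => x.1)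
      (g := fun x => x.2.1.append x.2.2) (by fun_prop) (by fun_prop))
      fun x => Equiv.symm_apply_eq (Tuple.appendEquiv σ τ)
  have happ : ∀ (a : Tuple M σ) (b : Tuple M τ), (Tuple.appendEquiv σ τ).symm (a.append b) = (a, b) :=
    fun a b => (Equiv.symm_apply_eq _).2 rfl
  induction h𝒳 with
  | base =>
    obtain ⟨𝒵, h𝒵, hsub⟩ := exists_injOn hC hCd h𝒴 (T := Tuple M []) (ξ := _ ++ τ)
      (g := fun x => ((Tuple.appendEquiv _ τ).symm x.2).2) (by fun_prop)
    refine ⟨𝒵, h𝒵, ?_⟩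
    rintro Z ⟨X, hX, Y, hY, hZ⟩
    refine hsub ⟨PUnit.unit, Y, hY, fun z hz => ?_, fun z hz z' hz' e => ?_⟩
    · obtain ⟨a, ha, b, hb, rfl⟩ := hZ hz
      simpa [happ] using hb
    · obtain ⟨a, ha, b, hb, rfl⟩ := hZ hz
      obtain ⟨a', ha', b', hb', rfl⟩ := hZ hz'
      simp only [happ] at e
      rw [e, hX ha ha']
  | @step π σ τ' hπ hτ f hf hfC 𝒳 h ih =>
    obtain ⟨𝒵, h𝒵, hsub⟩ := ih hr happ
    refine exists_step_map hC hCd hτ (T := Tuple M π)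
      (f := fun z => f (z.1, ((Tuple.appendEquiv _ τ).symm z.2).1)) (by fun_prop) h𝒵 ?_
    rintro Z ⟨X, ⟨p, hp⟩, Y, hY, hZ⟩
    refine ⟨p, fun z hz => ⟨hfC _, hsub
      ⟨_, hp (f (p, ((Tuple.appendEquiv _ τ).symm z).1)), Y, hY, ?_⟩⟩⟩
    · rintro z' ⟨hz', e⟩
      obtain ⟨a, ha, b, hb, rfl⟩ := hZ hz'
      simp only [happ] at e
      exact Tuple.append_mem_prod.2 ⟨⟨ha, e⟩, hb⟩

theorem exists_box (hC : ∀ s ∈ S₀, (C s).Nonempty)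
    (hCd : ∀ s ∈ S₀, ZeroDefinable L {a : Tuple M [s] | a.1 ∈ C s})
    {τ : List S} (hτ : ∀ s ∈ τ, s ∈ S₀) :
    ∃ 𝒳, Fib L S₀ C 𝒳 ∧ Tuple.box C τ ∈ 𝒳 := by
  obtain ⟨𝒳, h, h'⟩ := exists_step_map hC hCd hτ (T := Tuple M []) (f := fun z => z.2)
    (by fun_prop) .base (𝒳₀ := {Tuple.box C τ}) (by
      rintro _ rfl
      exact ⟨PUnit.unit, fun a ha => ⟨ha, fun b hb b' hb' => hb.2.trans hb'.2.symm⟩⟩)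
  exact ⟨𝒳, h, h' rfl⟩

/-- With base points `x₀`, `y₀` and two distinct elements of `C s`, the union embeds into `X × Y ×
C_s` by `x ↦ (x, y₀, c₀)` on `X` and `y ↦ (x₀, y, c₁)` off `X`. -/
theorem exists_union (hC : ∀ s ∈ S₀, (C s).Nonempty)
    (hCd : ∀ s ∈ S₀, ZeroDefinable L {a : Tuple M [s] | a.1 ∈ C s})
    (hC2 : ∃ s ∈ S₀, (C s).Nontrivial)
    {σ : List S} {𝒳 𝒴 : Set (Set (Tuple M σ))} (h𝒳 : Fib L S₀ C 𝒳) (h𝒴 : Fib L S₀ C 𝒴)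
    {X Y : Set (Tuple M σ)} (hX : X ∈ 𝒳) (hY : Y ∈ 𝒴) (hXd : Definable L X) :
    ∃ 𝒵, Fib L S₀ C 𝒵 ∧ X ∪ Y ∈ 𝒵 := by
  classical
  rcases X.eq_empty_or_nonempty with rfl | ⟨x₀, hx₀⟩
  · exact ⟨𝒴, h𝒴, by rwa [Set.empty_union]⟩
  rcases Y.eq_empty_or_nonempty with rfl | ⟨y₀, hy₀⟩
  · exact ⟨𝒳, h𝒳, by rwa [Set.union_empty]⟩
  obtain ⟨s, hs, c₀, hc₀, c₁, hc₁, hne⟩ := hC2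
  have hs' : ∀ t ∈ [s], t ∈ S₀ := by simpa using hs
  obtain ⟨ℬ, hℬ, hbox⟩ := exists_box hC hCd hs'
  obtain ⟨𝒲, h𝒲, hsub⟩ := exists_prod hC hCd h𝒳 h𝒴
  obtain ⟨𝒲', h𝒲', hsub'⟩ := exists_prod hC hCd h𝒲 hℬ
  let d₀ : Tuple M [s] := (c₀, PUnit.unit)
  let d₁ : Tuple M [s] := (c₁, PUnit.unit)
  have hd : d₀ ≠ d₁ := fun h => hne (congrArg Prod.fst h)
  obtain ⟨𝒵, h𝒵, hsub''⟩ := exists_injOn hC hCd h𝒲' (T := Tuple M []) (ξ := σ)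
    (g := fun z => if z.2 ∈ X then (z.2.append y₀).append d₀ else (x₀.append z.2).append d₁)
    (.ite ((definable_iff_defPred.1 hXd).comp (by fun_prop)) (by fun_prop) (by fun_prop))
  refine ⟨𝒵, h𝒵, hsub'' ⟨PUnit.unit, _, hsub' ⟨_, hsub ⟨X, hX, Y, hY, subset_rfl⟩, _, hbox,
    subset_rfl⟩, fun a ha => ?_, fun a ha a' ha' e => ?_⟩⟩
  · by_cases h : a ∈ X
    · simp only [h, if_true, Tuple.append_mem_prod]
      exact ⟨⟨trivial, hy₀⟩, hc₀, trivial⟩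
    · simp only [h, if_false, Tuple.append_mem_prod]
      exact ⟨⟨hx₀, ha.resolve_left h⟩, hc₁, trivial⟩
  · by_cases h : a ∈ X <;> by_cases h' : a' ∈ X <;>
      simp only [h, h', if_true, if_false, Tuple.append_inj_iff] at e
    · exact e.1.1
    · exact (hd e.2).elim
    · exact (hd e.2.symm).elim
    · exact e.1.2

end Fib

end Fib

/-! ### Splitting of concatenated tuples. -/

section Split

variable {S : Type u} {L : MSLanguage.{u, v, v'} S} {M : S → Type w} [LStructure L M]

/-- Splitting of a tuple into its two parts. -/
noncomputable def Tuple.split {σ τ : List S} (z : Tuple M (σ ++ τ)) : Tuple M σ × Tuple M τ :=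
  (Tuple.appendEquiv σ τ).symm z

@[simp] theorem Tuple.split_append {σ τ : List S} (a : Tuple M σ) (b : Tuple M τ) :
    (a.append b).split = (a, b) := (Equiv.symm_apply_eq _).2 rfl

@[simp] theorem Tuple.append_split {σ τ : List S} (z : Tuple M (σ ++ τ)) :
    z.split.1.append z.split.2 = z := (Tuple.appendEquiv σ τ).apply_symm_apply z

@[fun_prop] theorem DefMap.split {T : Type w} [Coord M T] {σ τ : List S}
    {f : T → Tuple M (σ ++ τ)} (hf : DefMap L f) : DefMap L fun t => (f t).split := by
  refine DefMap.comp (g := Tuple.split) ?_ hf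
  exact DefPred.congr (DefPred.eq (f := fun x : Tuple M (σ ++ τ) × (Tuple M σ × Tuple M τ) => x.1)
      (g := fun x => x.2.1.append x.2.2) (by fun_prop) (by fun_prop))
      fun x => Equiv.symm_apply_eq (Tuple.appendEquiv σ τ)

theorem Tuple.mem_prod_iff {σ τ : List S} {X : Set (Tuple M σ)} {Y : Set (Tuple M τ)}
    {z : Tuple M (σ ++ τ)} : z ∈ Tuple.prod X Y ↔ z.split.1 ∈ X ∧ z.split.2 ∈ Y := by
  rw [← Tuple.append_mem_prod, Tuple.append_split]

theorem definable_prod {σ τ : List S} {X : Set (Tuple M σ)} {Y : Set (Tuple M τ)}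
    (hX : Definable L X) (hY : Definable L Y) : Definable L (Tuple.prod X Y) :=
  DefPred.congr (T := Tuple M (σ ++ τ))
    (((definable_iff_defPred.1 hX).comp (g := fun z : Tuple M (σ ++ τ) => z.split.1)
      (by fun_prop)).and ((definable_iff_defPred.1 hY).comp
      (g := fun z : Tuple M (σ ++ τ) => z.split.2) (by fun_prop)))
    fun _ => Tuple.mem_prod_iff

end Split

/-! ### Fiberings versus `Fib`, and the closure of the fiberable class. -/

section Fiberings

variable {S : Type u} {L : MSLanguage.{u, v, v'} S} {M : S → Type w} [LStructure L M]
variable {S₀ : Set S} {C : ∀ s, Set (M s)}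

theorem DefFamily.defPred {π σ τ : List S} (f : DefFamily L M π σ τ) :
    DefPred L fun x : (Tuple M π × Tuple M σ) × Tuple M τ => f.rel x.1.1 x.1.2 x.2 := by
  refine DefPred.congr ((definable_iff_defPred.1 f.definable).comp
    (g := fun x : (Tuple M π × Tuple M σ) × Tuple M τ => x.1.1.append (x.1.2.append x.2))
    (by fun_prop)) ?_
  rintro ⟨⟨p, a⟩, b⟩
  change f.rel p a b ↔ ∃ p' a' b', f.rel p' a' b' ∧
    p.append (a.append b) = p'.append (a'.append b')
  constructor
  · exact fun h => ⟨p, a, b, h, rfl⟩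
  · rintro ⟨p', a', b', h, e⟩
    obtain ⟨rfl, e'⟩ := Tuple.append_injective e
    obtain ⟨rfl, rfl⟩ := Tuple.append_injective e'
    exact h

/-- The family of restrictions of a definable map to the members of a definable family of sets. -/
def DefFamily.restrict {π σ τ : List S} {f : Tuple M π × Tuple M σ → Tuple M τ} (hf : DefMap L f)
    {W : Tuple M π → Set (Tuple M σ)} (hW : DefFam L W) : DefFamily L M π σ τ where
  rel p a b := a ∈ W p ∧ f (p, a) = b
  functional _ _ _ _ h h' := h.2.symm.trans h'.2
  definable := by
    refine DefPred.congr (DefPred.comp (P := fun x : (Tuple M π × Tuple M σ) × Tuple M τ =>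
        x.1.2 ∈ W x.1.1 ∧ f x.1 = x.2)
      (.and (hW.mem (by fun_prop) (by fun_prop)) (.eq (by fun_prop) (by fun_prop)))
      (g := fun z : Tuple M (π ++ (σ ++ τ)) => ((z.split.1, z.split.2.split.1), z.split.2.split.2))
      (by fun_prop)) fun z => ?_
    constructor
    · rintro ⟨p, a, b, h, rfl⟩
      simpa using h
    · exact fun h => ⟨_, _, _, h, by simp⟩

/-- The factor `f₁(X)` in the next stage can be dropped: `a ↦ (a, b)` embeds the fiber over `b` into
the product, so `exists_injOn` applies with `b` as parameter. -/
theorem FiberingData.exists_fib (hC : ∀ s ∈ S₀, (C s).Nonempty)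
    (hCd : ∀ s ∈ S₀, ZeroDefinable L {a : Tuple M [s] | a.1 ∈ C s})
    {r : ℕ} {π σ : List S} (d : FiberingData L M S₀ r π σ) :
    ∃ 𝒳, Fib L S₀ C 𝒳 ∧ {X | ∃ p, d.IsFibering C p X} ⊆ 𝒳 := by
  induction d with
  | zero τ hτ f =>
    refine Fib.exists_step hC hCd hτ f.defPred f.functional .base ?_
    rintro X ⟨p, hdom, hran, hinj⟩
    refine ⟨p, fun a ha => ?_⟩
    rw [← hdom] at ha
    obtain ⟨b, hb⟩ := ha
    exact ⟨b, hran ⟨a, hb⟩, hb, fun a₁ h₁ a₂ h₂ => hinj _ _ _ h₁.2 h₂.2⟩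
  | @succ r π σ τ hτ f ρ next ih =>
    obtain ⟨𝒴, h𝒴, hsub⟩ := ih
    obtain ⟨𝒵, h𝒵, hsub'⟩ := Fib.exists_injOn hC hCd h𝒴 (T := Tuple M τ) (ξ := σ)
      (g := fun z => z.2.append z.1) (by fun_prop)
    refine Fib.exists_step hC hCd hτ f.defPred f.functional h𝒵 ?_
    rintro X ⟨p, hdom, hran, hnext⟩
    refine ⟨p, fun a ha => ?_⟩
    rw [← hdom] at ha
    obtain ⟨b, hb⟩ := ha
    obtain ⟨q, hq⟩ := hnext b ⟨a, hb⟩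
    refine ⟨b, hran ⟨a, hb⟩, hb, hsub' ⟨b, _, hsub ⟨_, hq⟩, fun a' ha' => ?_, ?_⟩⟩
    · exact Tuple.append_mem_prod.2 ⟨ha'.2, a, hb⟩
    · exact fun a₁ _ a₂ _ e => (Tuple.append_injective e).1

theorem FiberingData.isFibering_cast {r : ℕ} {π π' σ : List S} (e : π = π')
    (d : FiberingData L M S₀ r π σ) (p : Tuple M π) (X : Set (Tuple M σ)) :
    (e ▸ d).IsFibering C (e ▸ p) X ↔ d.IsFibering C p X := by
  subst e
  rfl

/-- The image factors that accumulate in a fibering also have to be separated at the end. The map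
`g` leads to the set being decomposed, while `k` records the accumulated coordinates in a box. When
`g` has become constant on `W p`, joint injectivity leaves `k` injective, which is a 0-step
fibering. -/
theorem Fib.exists_fiberingData {σ : List S} {𝒳 : Set (Set (Tuple M σ))} (h𝒳 : Fib L S₀ C 𝒳) :
    ∀ {ξ π τ' : List S} (_ : ∀ s ∈ τ', s ∈ S₀) {g : Tuple M π × Tuple M ξ → Tuple M σ}
      {k : Tuple M π × Tuple M ξ → Tuple M τ'} {W : Tuple M π → Set (Tuple M ξ)}
      (_ : DefMap L g) (_ : DefMap L k) (_ : DefFam L W),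
    ∃ (r : ℕ) (ρ : List S) (d : FiberingData L M S₀ r (π ++ ρ) ξ), ∀ p,
      (∃ X ∈ 𝒳, ∀ a ∈ W p, g (p, a) ∈ X) → (∀ a ∈ W p, k (p, a) ∈ Tuple.box C τ') →
      Set.InjOn (fun a => (g (p, a), k (p, a))) (W p) →
      ∃ q : Tuple M ρ, d.IsFibering C (p.append q) (W p) := by
  induction h𝒳 with
  | @base σ =>
    intro ξ π τ' hτ' g k W hg hk hW
    have hk' : DefMap L fun z : Tuple M (π ++ []) × Tuple M ξ => k (z.1.split.1, z.2) := by fun_prop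
    have hW' : DefFam L fun z : Tuple M (π ++ []) => W z.split.1 := hW.comp (by fun_prop)
    refine ⟨0, [], .zero τ' hτ' (DefFamily.restrict hk' hW'), ?_⟩
    rintro p ⟨X, hX, hg⟩ hk hinj
    obtain ⟨q⟩ : Nonempty (Tuple M []) := ⟨PUnit.unit⟩
    refine ⟨q, ?_, ?_, ?_⟩
    · ext a
      simp [DefFamily.dom, DefFamily.restrict]
    · rintro _ ⟨a, ha, rfl⟩
      simp only [Tuple.split_append] at ha ⊢
      exact hk a ha
    · rintro a a' b ⟨ha, hb⟩ ⟨ha', hb'⟩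
      simp only [Tuple.split_append] at ha ha' hb hb'
      exact hinj ha ha' (Prod.ext (hX (hg a ha) (hg a' ha')) (hb.trans hb'.symm))
  | @step π₁ σ τ hπ hτ f hf hfC 𝒴 h ih =>
    intro ξ π τ' hτ' g k W hg hk hW
    have hF : DefMap L fun z : Tuple M (π ++ π₁) × Tuple M ξ =>
      f (z.1.split.2, g (z.1.split.1, z.2)) := by fun_prop
    have hWF : DefFam L fun z : Tuple M (π ++ π₁) => W z.split.1 := hW.comp (by fun_prop)
    let F := DefFamily.restrict hF hWF
    have hg' : DefMap L fun z : Tuple M ((π ++ π₁) ++ τ) × Tuple M (ξ ++ τ) =>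
      g (z.1.split.1.split.1, z.2.split.1) := by fun_prop
    -- The new factor of the domain, the image of `F`, already lies in a box and is appended to the
    -- record `k`.
    have hk' : DefMap L fun z : Tuple M ((π ++ π₁) ++ τ) × Tuple M (ξ ++ τ) =>
      (k (z.1.split.1.split.1, z.2.split.1)).append z.2.split.2 := by fun_prop
    have hWn : DefFam L fun z : Tuple M ((π ++ π₁) ++ τ) =>
        Tuple.prod (F.fiber z.split.1 z.split.2) (F.range z.split.1) := by
      refine DefPred.congr (P := fun z : Tuple M ((π ++ π₁) ++ τ) × Tuple M (ξ ++ τ) =>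
        F.rel z.1.split.1 z.2.split.1 z.1.split.2 ∧ ∃ a, F.rel z.1.split.1 a z.2.split.2)
        (.and ?_ (.ex ?_)) fun z => Tuple.mem_prod_iff
      · exact F.defPred.comp (g := fun z : Tuple M ((π ++ π₁) ++ τ) × Tuple M (ξ ++ τ) =>
          ((z.1.split.1, z.2.split.1), z.1.split.2)) (by fun_prop)
      · exact F.defPred.comp
          (g := fun z : (Tuple M ((π ++ π₁) ++ τ) × Tuple M (ξ ++ τ)) × Tuple M ξ =>
            ((z.1.1.split.1, z.2), z.1.2.split.2)) (by fun_prop)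
    obtain ⟨r, ρ, d, hd⟩ := ih (τ' := τ' ++ τ)
      (fun s hs => (List.mem_append.1 hs).elim (hτ' s) (hτ s)) hg' hk' hWn
    -- The parameter of the next stage may depend on the fiber, so it can contain the value `b`
    -- itself. The family of fibers to be treated next is then definable in that parameter.
    refine ⟨r + 1, π₁, .succ τ hτ F (τ ++ ρ) (List.append_assoc (π ++ π₁) τ ρ ▸ d), ?_⟩
    rintro p ⟨X, ⟨p₁, hp₁⟩, hgX⟩ hkC hinj
    refine ⟨p₁, ?_, ?_, fun b hb => ?_⟩
    · ext a
      simp [DefFamily.dom, F, DefFamily.restrict]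
    · rintro _ ⟨a, ha, rfl⟩
      exact hfC _
    suffices h : ∃ q, d.IsFibering C (((p.append p₁).append b).append q) _ by
      obtain ⟨q, hq⟩ := h
      refine ⟨b.append q, ?_⟩
      rw [← Tuple.append_assoc_cast, FiberingData.isFibering_cast]
      exact hq
    have hd' := hd ((p.append p₁).append b)
    simp only [Tuple.split_append] at hd'
    refine hd' ⟨_, hp₁ b, ?_⟩ ?_ ?_
    · intro z hz
      rw [Tuple.mem_prod_iff] at hz
      obtain ⟨⟨h1, h2⟩, -⟩ := hz
      simp only [Tuple.split_append] at h1 h2 ⊢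
      exact ⟨hgX _ h1, h2⟩
    · intro z hz
      rw [Tuple.mem_prod_iff] at hz
      obtain ⟨⟨h1, h2⟩, ⟨a, ha, hab⟩⟩ := hz
      simp only [Tuple.split_append] at h1 hab ⊢
      refine Tuple.append_mem_box.2 ⟨hkC _ h1, ?_⟩
      rw [← hab]
      exact hfC _
    · intro z hz z' hz' e
      rw [Tuple.mem_prod_iff] at hz hz'
      have h1 := hz.1.1
      have h1' := hz'.1.1
      simp only [Tuple.split_append, Prod.mk.injEq, Tuple.append_inj_iff] at h1 h1' e
      have := hinj h1 h1' (Prod.ext e.1 e.2.1)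
      rw [← Tuple.append_split z, ← Tuple.append_split z', this, e.2.2]

theorem mem_fiberableClass_iff (hC : ∀ s ∈ S₀, (C s).Nonempty)
    (hCd : ∀ s ∈ S₀, ZeroDefinable L {a : Tuple M [s] | a.1 ∈ C s})
    {σ : List S} {X : Set (Tuple M σ)} :
    X ∈ fiberableClass L S₀ C σ ↔ Definable L X ∧ ∃ 𝒳, Fib L S₀ C 𝒳 ∧ X ∈ 𝒳 := by
  refine and_congr_right fun hX => ⟨?_, ?_⟩
  · rintro ⟨r, d, hd⟩
    obtain ⟨𝒳, h𝒳, h⟩ := d.exists_fib hC hCd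
    exact ⟨𝒳, h𝒳, h ⟨_, hd⟩⟩
  · rintro ⟨𝒳, h𝒳, hX𝒳⟩
    have hc : DefMap (U := Tuple M []) L fun _ : Tuple M [] × Tuple M σ => PUnit.unit :=
      .const _
    have hg : DefMap L fun z : Tuple M [] × Tuple M (σ ++ []) => z.2.split.1 := by fun_prop
    have hk : DefMap (U := Tuple M []) L fun _ : Tuple M [] × Tuple M (σ ++ []) => PUnit.unit :=
      .const _
    have hu : Definable L (Set.univ : Set (Tuple M [])) :=
      DefPred.true (T := Tuple M [])
    obtain ⟨r, ρ, d, hd⟩ := h𝒳.exists_fiberingData (τ' := []) (by simp) hg hk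
      (DefFam.const (T := Tuple M []) (definable_prod hX hu))
    -- The first map of a fibering has no parameters. A preliminary constant map to a point, with
    -- single fiber `X`, makes room for choosing `q`.
    refine ⟨r + 1, .succ [] (by simp)
      (DefFamily.restrict hc (DefFam.const (T := Tuple M []) hX)) ρ d, ?_⟩
    refine ⟨?_, ?_, ?_⟩
    · exact Set.ext fun a => ⟨fun ⟨_, h, _⟩ => h, fun h => ⟨_, h, rfl⟩⟩
    · exact fun _ _ => trivial
    · intro b hb
      obtain ⟨q, hq⟩ := hd PUnit.unit ⟨X, hX𝒳, fun a ha => (Tuple.mem_prod_iff.1 ha).1⟩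
        (fun _ _ => trivial) fun z _ z' _ e => by
          rw [← Tuple.append_split z, ← Tuple.append_split z', (Prod.ext_iff.1 e).1]
          rfl
      refine ⟨q, ?_⟩
      convert hq using 2
      · ext a
        exact ⟨fun h => h.1, fun h => ⟨h, rfl⟩⟩
      · exact Set.eq_univ_of_forall fun _ => hb

theorem isClosedClass_fiberableClass (hC : ∀ s ∈ S₀, (C s).Nonempty)
    (hCd : ∀ s ∈ S₀, ZeroDefinable L {a : Tuple M [s] | a.1 ∈ C s})
    (hC2 : ∃ s ∈ S₀, (C s).Nontrivial) : IsClosedClass L (fiberableClass L S₀ C) where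
  definable h := h.1
  union {σ X Y} hX hY := by
    rw [mem_fiberableClass_iff hC hCd] at *
    obtain ⟨hXd, 𝒳, h𝒳, hX⟩ := hX
    obtain ⟨hYd, 𝒴, h𝒴, hY⟩ := hY
    exact ⟨DefPred.or (definable_iff_defPred.1 hXd) (definable_iff_defPred.1 hYd),
      Fib.exists_union hC hCd hC2 h𝒳 h𝒴 hX hY hXd⟩
  subset {σ X Y} hX hYX hY := by
    rw [mem_fiberableClass_iff hC hCd] at *
    obtain ⟨hXd, 𝒳, h𝒳, hX⟩ := hX
    exact ⟨hY, 𝒳, h𝒳, h𝒳.mono hX hYX⟩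
  prod {σ τ X Y} hX hY := by
    rw [mem_fiberableClass_iff hC hCd] at *
    obtain ⟨hXd, 𝒳, h𝒳, hX⟩ := hX
    obtain ⟨hYd, 𝒴, h𝒴, hY⟩ := hY
    obtain ⟨𝒵, h𝒵, h⟩ := Fib.exists_prod hC hCd h𝒳 h𝒴
    exact ⟨definable_prod hXd hYd, 𝒵, h𝒵, h ⟨X, hX, Y, hY, subset_rfl⟩⟩

theorem defClass_subset_fiberableClass (hC : ∀ s ∈ S₀, (C s).Nonempty)
    (hCd : ∀ s ∈ S₀, ZeroDefinable L {a : Tuple M [s] | a.1 ∈ C s}) (σ : List S) :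
    defClass L S₀ C σ ⊆ fiberableClass L S₀ C σ := by
  rintro X ⟨hσ, hX, hXd⟩
  obtain ⟨𝒳, h𝒳, h⟩ := Fib.exists_box hC hCd hσ
  exact (mem_fiberableClass_iff hC hCd).2 ⟨hXd, 𝒳, h𝒳, h𝒳.mono h hX⟩

end Fiberings

/-! ### Functions with finitely many values and definable level sets. -/

section Simple

variable {S : Type u} (L : MSLanguage.{u, v, v'} S) {M : S → Type w} [LStructure L M]
variable {T U : Type w} [Coord M T] [Coord M U] {A B D : Type*}

/-- Functions that take finitely many values, with definable level sets. -/
def Simple (h : T → A) : Prop := (Set.range h).Finite ∧ ∀ a, DefPred L fun t => h t = a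

variable {L}

namespace Simple

theorem const (a : A) : Simple L fun _ : T => a :=
  ⟨(Set.finite_singleton a).subset (by rintro _ ⟨t, rfl⟩; rfl), fun _ => .const _⟩

theorem comp {h : T → A} (hh : Simple L h) {f : U → T} (hf : DefMap L f) :
    Simple L fun u => h (f u) :=
  ⟨hh.1.subset (by rintro _ ⟨t, rfl⟩; exact ⟨_, rfl⟩), fun a => (hh.2 a).comp hf⟩

theorem prodMk {h : T → A} {k : T → B} (hh : Simple L h) (hk : Simple L k) :
    Simple L fun t => (h t, k t) :=
  ⟨(hh.1.prod hk.1).subset (by rintro _ ⟨t, rfl⟩; exact ⟨⟨t, rfl⟩, ⟨t, rfl⟩⟩),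
    fun a => ((hh.2 a.1).and (hk.2 a.2)).congr fun _ => Prod.ext_iff⟩

theorem map {h : T → A} (hh : Simple L h) (g : A → B) : Simple L fun t => g (h t) := by
  refine ⟨(hh.1.image g).subset (by rintro _ ⟨t, rfl⟩; exact ⟨_, ⟨t, rfl⟩, rfl⟩), fun b => ?_⟩
  classical
  refine (DefPred.finset_or (hh.1.toFinset.filter fun a => g a = b) hh.2).congr fun t => ?_
  simp

theorem of_defPred {P : T → Prop} (hP : DefPred L P) : Simple L P := by
  refine ⟨Set.toFinite _, fun Q => ?_⟩
  by_cases hQ : Q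
  · exact hP.congr fun t => by simp [hQ]
  · exact hP.not.congr fun t => by simp [hQ]

theorem finset_sum [AddCommMonoid A] {ι : Type*} (s : Finset ι) {h : ι → T → A}
    (hh : ∀ i, Simple L (h i)) : Simple L fun t => ∑ i ∈ s, h i t := by
  classical
  induction s using Finset.induction_on with
  | empty => simpa using const 0
  | insert i s hi ih =>
    simp only [Finset.sum_insert hi]
    exact ((hh i).prodMk ih).map fun p => p.1 + p.2

end Simple

end Simple

/-! ### Consequences of the Fubini axioms. -/

section Fubini

variable {S : Type u} {L : MSLanguage.{u, v, v'} S} {M : S → Type w} [LStructure L M]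
variable {A : Type x} [CommSemiring A] {𝒞 : SetClass M} {ν : ∀ σ : List S, Set (Tuple M σ) → A}

namespace IsFubiniMeasure

variable {σ τ : List S} {X : Set (Tuple M σ)} {Y : Set (Tuple M τ)} {f : Tuple M σ → Tuple M τ}

theorem fiber_restrict (hXY : Set.MapsTo f X Y) (b : Y) :
    fiber (hXY.restrict f X Y) b = X ∩ {a | f a = b} := by
  ext a
  constructor
  · rintro ⟨a, ha, rfl⟩
    exact ⟨a.2, congrArg Subtype.val ha⟩
  · rintro ⟨ha, hb⟩
    exact ⟨⟨a, ha⟩, Subtype.ext hb, rfl⟩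

theorem definable_graph_restrict (hX : Definable L X) (hf : DefMap L f) (hXY : Set.MapsTo f X Y) :
    Definable L (graph (hXY.restrict f X Y)) := by
  have h : DefPred L fun x : Tuple M σ × Tuple M τ => x.1 ∈ X ∧ f x.1 = x.2 :=
    .and ((definable_iff_defPred.1 hX).comp (by fun_prop)) (.eq (by fun_prop) (by fun_prop))
  refine DefPred.congr (definable_iff_defPred.1 (definable_append_iff (R := fun a b => a ∈ X ∧ f a = b).2 h))
    fun z => ?_
  constructor
  · rintro ⟨a, rfl⟩
    exact ⟨a, f a, ⟨a.2, rfl⟩, rfl⟩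
  · rintro ⟨a, _, ⟨ha, rfl⟩, rfl⟩
    exact ⟨⟨a, ha⟩, rfl⟩

variable (hν : IsFubiniMeasure L 𝒞 ν)
  (h𝒞 : ∀ {σ : List S} {X : Set (Tuple M σ)}, X ∈ 𝒞 σ → Definable L X)
include hν h𝒞

theorem finite_image (hX : X ∈ 𝒞 σ) (hY : Y ∈ 𝒞 τ) (hf : DefMap L f) (hXY : Set.MapsTo f X Y) :
    ((fun b => ν σ (X ∩ {a | f a = b})) '' Y).Finite := by
  refine (hν.finite σ τ X Y hX hY _ (definable_graph_restrict (h𝒞 hX) hf hXY)).subset ?_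
  rintro _ ⟨b, hb, rfl⟩
  exact ⟨⟨b, hb⟩, congrArg (ν σ) (fiber_restrict hXY ⟨b, hb⟩)⟩

theorem definable_level (hX : X ∈ 𝒞 σ) (hY : Y ∈ 𝒞 τ) (hf : DefMap L f)
    (hXY : Set.MapsTo f X Y) (a : A) : Definable L {b | b ∈ Y ∧ ν σ (X ∩ {a | f a = b}) = a} := by
  convert hν.definable σ τ X Y hX hY _ (definable_graph_restrict (h𝒞 hX) hf hXY) a using 1
  ext b
  constructor
  · rintro ⟨hb, h⟩
    exact ⟨⟨b, hb⟩, by rwa [Set.mem_ofPred_eq, fiber_restrict], rfl⟩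
  · rintro ⟨b, h, rfl⟩
    rw [Set.mem_ofPred_eq, fiber_restrict] at h
    exact ⟨b.2, h⟩

theorem eq_mul (hX : X ∈ 𝒞 σ) (hY : Y ∈ 𝒞 τ) (hf : DefMap L f) (hXY : Set.MapsTo f X Y) {a : A}
    (ha : ∀ b ∈ Y, ν σ (X ∩ {a | f a = b}) = a) : ν σ X = a * ν τ Y :=
  hν.fubini σ τ X Y hX hY _ (definable_graph_restrict (h𝒞 hX) hf hXY) a fun b => by
    rw [fiber_restrict]
    exact ha b b.2

variable (hsub : ∀ {σ : List S} {X Y : Set (Tuple M σ)}, X ∈ 𝒞 σ → Y ⊆ X → Definable L Y → Y ∈ 𝒞 σ)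
include hsub

/-- This is (F3) with singleton fibers, hence with constant 1. -/
theorem eq_of_bijOn (hX : X ∈ 𝒞 σ) (hY : Y ∈ 𝒞 τ) (hf : DefMap L f) (hXY : Set.BijOn f X Y) :
    ν σ X = ν τ Y := by
  rw [hν.eq_mul h𝒞 hX hY hf hXY.mapsTo (a := 1), one_mul]
  intro b hb
  obtain ⟨a, ha, rfl⟩ := hXY.surjOn hb
  have h : X ∩ {a' | f a' = f a} = {a} := by
    ext a'
    constructor
    · rintro ⟨h1, h2⟩
      exact hXY.injOn h1 ha h2
    · rintro rfl
      exact ⟨ha, rfl⟩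
  rw [h]
  exact hν.singleton σ a (hsub hX (Set.singleton_subset_iff.2 ha)
    (DefPred.eq (f := fun z : Tuple M σ => z) (g := fun _ => a) (by fun_prop) (by fun_prop)))

omit h𝒞 in
theorem sum_levels {ι : Type*} (hX : X ∈ 𝒞 σ) {k : Tuple M σ → ι}
    (hk : ∀ i, DefPred L fun a => a ∈ X ∧ k a = i) (s : Finset ι) :
    Definable L {a | a ∈ X ∧ k a ∈ s} ∧
      ν σ {a | a ∈ X ∧ k a ∈ s} = ∑ i ∈ s, ν σ {a | a ∈ X ∧ k a = i} := by
  classical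
  induction s using Finset.induction_on with
  | empty =>
    have h : {a | a ∈ X ∧ k a ∈ (∅ : Finset ι)} = ∅ := by simp
    have hd : Definable L (∅ : Set (Tuple M σ)) := DefPred.false (T := Tuple M σ)
    rw [h, Finset.sum_empty]
    exact ⟨hd, hν.empty σ (hsub hX (Set.empty_subset _) hd)⟩
  | insert i s hi ih =>
    have h : {a | a ∈ X ∧ k a ∈ insert i s} =
        {a | a ∈ X ∧ k a = i} ∪ {a | a ∈ X ∧ k a ∈ s} := by
      ext a
      simp only [Finset.mem_insert, Set.mem_ofPred_eq, Set.mem_union]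
      tauto
    rw [h, Finset.sum_insert hi, ← ih.2]
    have hd : Definable L {a | a ∈ X ∧ k a = i} := hk i
    refine ⟨DefPred.or (T := Tuple M σ) hd ih.1, hν.union _ _ _ (hsub hX (fun a ha => ha.1) hd)
      (hsub hX (fun a ha => ha.1) ih.1) ?_⟩
    rw [Set.disjoint_left]
    rintro a ⟨-, rfl⟩ ⟨-, h⟩
    exact hi h

/-- Cut `X` according to the measure of the fiber through each point. There are finitely many pieces
by (F1), they are definable by (F2), and (F3) applies to each since its fibers over the
corresponding level set of `Y` are whole fibers of `X`. -/
theorem eq_finsum (hX : X ∈ 𝒞 σ) (hY : Y ∈ 𝒞 τ) (hf : DefMap L f) (hXY : Set.MapsTo f X Y) :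
    ν σ X = ∑ᶠ a, a * ν τ {b | b ∈ Y ∧ ν σ (X ∩ {a | f a = b}) = a} := by
  have hfin := hν.finite_image h𝒞 hX hY hf hXY
  have hdef := hν.definable_level h𝒞 hX hY hf hXY
  rw [finsum_eq_sum_of_support_subset (s := hfin.toFinset)]
  · have hk : ∀ c, DefPred L fun a => a ∈ X ∧ ν σ (X ∩ {a' | f a' = f a}) = c := fun c =>
      DefPred.congr (.and (definable_iff_defPred.1 (h𝒞 hX))
        ((definable_iff_defPred.1 (hdef c)).comp hf))
        fun a => ⟨fun h => ⟨h.1, hXY h.1, h.2⟩, fun h => ⟨h.1, h.2.2⟩⟩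
    have h := (hν.sum_levels hsub hX hk hfin.toFinset).2
    have hX' : {a | a ∈ X ∧ ν σ (X ∩ {a' | f a' = f a}) ∈ hfin.toFinset} = X := by
      ext a
      simp only [Set.Finite.mem_toFinset, Set.mem_ofPred_eq, and_iff_left_iff_imp]
      exact fun ha => ⟨f a, hXY ha, rfl⟩
    rw [hX'] at h
    refine h.trans (Finset.sum_congr rfl fun c _ => ?_)
    refine hν.eq_mul h𝒞 (f := f) (hsub hX (fun a ha => ha.1) (hk c)) (hsub hY (fun b hb => hb.1) (hdef c))
      hf (fun a ha => ⟨hXY ha.1, ha.2⟩) fun b hb => ?_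
    refine Eq.trans (congrArg (ν σ) ?_) hb.2
    ext a
    constructor
    · rintro ⟨h1, h2⟩
      exact ⟨h1.1, h2⟩
    · rintro ⟨h1, rfl⟩
      exact ⟨⟨h1, hb.2⟩, rfl⟩
  · intro c hc
    by_contra hc'
    refine hc ?_
    have h : {b | b ∈ Y ∧ ν σ (X ∩ {a | f a = b}) = c} = ∅ := by
      refine Set.eq_empty_of_forall_notMem ?_
      rintro b ⟨hb, rfl⟩
      exact hc' (hfin.mem_toFinset.2 ⟨b, hb, rfl⟩)
    have he : ν τ ∅ = 0 := hν.empty τ (hsub hY (Set.empty_subset _) (DefPred.false (T := Tuple M τ)))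
    simp only [h, he, mul_zero]

end IsFubiniMeasure

end Fubini

/-! ### Integration of simple functions over boxes. -/

section Integral

variable {S : Type u} {L : MSLanguage.{u, v, v'} S} {M : S → Type w} [LStructure L M]
variable {A : Type x} [CommSemiring A] {S₀ : Set S} {C : ∀ s, Set (M s)}
variable {μ : ∀ σ : List S, Set (Tuple M σ) → A}

variable (C μ) in
/-- The integral over `Tuple.box C τ` of a function with finitely many values. -/
noncomputable def integral (τ : List S) (h : Tuple M τ → A) : A :=
  ∑ᶠ a, a * μ τ {b | b ∈ Tuple.box C τ ∧ h b = a}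

theorem integral_congr {τ : List S} {h k : Tuple M τ → A} (hk : ∀ b ∈ Tuple.box C τ, h b = k b) :
    integral C μ τ h = integral C μ τ k := by
  unfold integral
  refine finsum_congr fun a => ?_
  congr 2
  ext b
  exact and_congr_right fun hb => by rw [hk b hb]

variable (L S₀ C μ) in
/-- A Fubini measure on the definable subsets of the products of the sets `C s`, which form a
stably embedded class. -/
structure StableFubini : Prop where
  nonempty : ∀ s ∈ S₀, (C s).Nonempty
  zeroDefinable : ∀ s ∈ S₀, ZeroDefinable L {a : Tuple M [s] | a.1 ∈ C s}
  stable : StablyEmbedded L S₀ C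
  fubini : IsFubiniMeasure L (defClass L S₀ C) μ

namespace StableFubini

variable (H : StableFubini L S₀ C μ) {τ τ' : List S} (hτ : ∀ s ∈ τ, s ∈ S₀) (hτ' : ∀ s ∈ τ', s ∈ S₀)
variable {T : Type w} [Coord M T]

theorem subset_mem {σ : List S} {X Y : Set (Tuple M σ)} (hX : X ∈ defClass L S₀ C σ) (hY : Y ⊆ X)
    (hYd : Definable L Y) : Y ∈ defClass L S₀ C σ := ⟨hX.1, hY.trans hX.2.1, hYd⟩

include H

theorem box_mem (hτ : ∀ s ∈ τ, s ∈ S₀) : Tuple.box C τ ∈ defClass L S₀ C τ :=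
  ⟨hτ, subset_rfl, defPred_box H.zeroDefinable hτ⟩

theorem sep_mem (hτ : ∀ s ∈ τ, s ∈ S₀) {P : Tuple M τ → Prop} (hP : DefPred L P) :
    {b | b ∈ Tuple.box C τ ∧ P b} ∈ defClass L S₀ C τ :=
  subset_mem (H.box_mem hτ) (fun _ h => h.1) (DefPred.and (defPred_box H.zeroDefinable hτ) hP)

theorem eq_of_bijOn {σ τ : List S} {X : Set (Tuple M σ)} {Y : Set (Tuple M τ)}
    (hX : X ∈ defClass L S₀ C σ) (hY : Y ∈ defClass L S₀ C τ) {f : Tuple M σ → Tuple M τ}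
    (hf : DefMap L f) (hXY : Set.BijOn f X Y) : μ σ X = μ τ Y :=
  H.fubini.eq_of_bijOn (fun h => h.2.2) subset_mem hX hY hf hXY

include hτ

/-- Any finer finite definable partition computes the same integral: by additivity the level sets of
`k` regroup into those of `g ∘ k`. Linearity follows by taking `k` to be a common refinement. -/
theorem integral_eq_sum {ι : Type*} {k : Tuple M τ → ι} (hk : Simple L k) {s : Finset ι}
    (hs : ∀ b ∈ Tuple.box C τ, k b ∈ s) (g : ι → A) :
    integral C μ τ (fun b => g (k b)) = ∑ i ∈ s, g i * μ τ {b | b ∈ Tuple.box C τ ∧ k b = i} := by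
  classical
  unfold integral
  have hdef : ∀ i, DefPred L fun b => b ∈ Tuple.box C τ ∧ k b = i := fun i =>
    .and (defPred_box H.zeroDefinable hτ) (hk.2 i)
  have h : ∀ a, μ τ {b | b ∈ Tuple.box C τ ∧ g (k b) = a} =
      ∑ i ∈ s with g i = a, μ τ {b | b ∈ Tuple.box C τ ∧ k b = i} := by
    intro a
    rw [← (H.fubini.sum_levels subset_mem (H.box_mem hτ) hdef (s.filter fun i => g i = a)).2]
    congr 1
    ext b
    simp only [Set.mem_ofPred_eq, Finset.mem_filter]
    exact and_congr_right fun hb => (and_iff_right (hs b hb)).symm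
  rw [finsum_eq_sum_of_support_subset (s := s.image g)]
  · rw [← Finset.sum_fiberwise_of_maps_to (g := g) (t := s.image g)
      fun i hi => Finset.mem_image_of_mem _ hi]
    refine Finset.sum_congr rfl fun a _ => ?_
    rw [h, Finset.mul_sum]
    refine Finset.sum_congr rfl fun i hi => ?_
    rw [(Finset.mem_filter.1 hi).2]
  · intro a ha
    by_contra ha'
    refine ha ?_
    have : s.filter (fun i => g i = a) = ∅ := by
      refine Finset.filter_eq_empty_iff.2 ?_
      rintro i hi rfl
      exact ha' (Finset.mem_coe.2 (Finset.mem_image_of_mem _ hi))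
    simp only [h, this, Finset.sum_empty, mul_zero]

theorem integral_add {h k : Tuple M τ → A} (hh : Simple L h) (hk : Simple L k) :
    integral C μ τ (fun b => h b + k b) = integral C μ τ h + integral C μ τ k := by
  have hhk := hh.prodMk hk
  have hs : ∀ b ∈ Tuple.box C τ, (h b, k b) ∈ hhk.1.toFinset := fun b _ =>
    hhk.1.mem_toFinset.2 ⟨b, rfl⟩
  rw [H.integral_eq_sum hτ hhk hs fun p => p.1 + p.2, H.integral_eq_sum hτ hhk hs Prod.fst,
    H.integral_eq_sum hτ hhk hs Prod.snd, ← Finset.sum_add_distrib]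
  simp only [add_mul]

theorem integral_const_mul {h : Tuple M τ → A} (hh : Simple L h) (a : A) :
    integral C μ τ (fun b => a * h b) = a * integral C μ τ h := by
  have hs : ∀ b ∈ Tuple.box C τ, h b ∈ hh.1.toFinset := fun b _ => by simp
  rw [H.integral_eq_sum hτ hh hs fun p => a * p, H.integral_eq_sum hτ hh hs fun p => p,
    Finset.mul_sum]
  simp only [mul_assoc]

theorem integral_zero : integral C μ τ (fun _ => 0) = 0 := by
  have := H.integral_const_mul hτ (Simple.const (L := L) (T := Tuple M τ) (0 : A)) 0
  simpa using this

theorem integral_finset_sum {ι : Type*} (s : Finset ι) {h : ι → Tuple M τ → A}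
    (hh : ∀ i, Simple L (h i)) :
    integral C μ τ (fun b => ∑ i ∈ s, h i b) = ∑ i ∈ s, integral C μ τ (h i) := by
  classical
  induction s using Finset.induction_on with
  | empty => simpa using H.integral_zero hτ
  | insert i s hi ih =>
    simp only [Finset.sum_insert hi]
    rw [H.integral_add hτ (hh i) (Simple.finset_sum s hh), ih]

open Classical in
theorem integral_indicator {P : Tuple M τ → Prop} (hP : DefPred L P) :
    integral C μ τ (fun b => if P b then 1 else 0) = μ τ {b | b ∈ Tuple.box C τ ∧ P b} := by
  rw [H.integral_eq_sum hτ (Simple.of_defPred hP) (s := {True, False}) (fun b _ => by simpa using Classical.em _)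
    (fun Q => if Q then 1 else 0)]
  simp

/-- In a stably embedded class, the measure of the members of a definable family is a function with
finitely many values and definable level sets. -/
theorem simple_section {D : T → Set (Tuple M τ)} (hD : DefFam L D) :
    Simple L fun t => μ τ {b | b ∈ Tuple.box C τ ∧ b ∈ D t} := by
  obtain ⟨ρ, p, φ, h⟩ := hD
  -- Stable embeddedness concerns 0-definable relations, so the parameters `p` of the family are
  -- grouped with `t` on the side to be replaced by a code `c`.
  let e : ∀ s, Var (ρ ++ (Coord.ctx T ++ τ)) s → Var ((ρ ++ Coord.ctx T) ++ τ) s :=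
    Var.elim (fun _ i => i.inl.inl) (Var.elim (fun _ i => (Var.inr ρ i).inl) fun _ i => Var.inr _ i)
  have he : ∀ (k : Tuple M (Coord.ctx T)) (b : Tuple M τ),
      Tuple.pull e ((p.append k).append b) = p.append (k.append b) := by
    intro k b
    simp only [e]
    rw [Tuple.pull_elim, Tuple.pull_elim, Tuple.pull_inr,
      ← Tuple.pull_pull (fun _ i => i.inl) (fun _ i => i.inl),
      ← Tuple.pull_pull (fun _ i => Var.inr ρ i) (fun _ i => i.inl), Tuple.pull_inl,
      Tuple.pull_inl, Tuple.pull_inr]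
  obtain ⟨ρ', hρ', 𝒯, h𝒯, hT⟩ := H.stable (ρ ++ Coord.ctx T) τ hτ
    {z | (φ.rename e).Realize z} ⟨_, fun _ => Iff.rfl⟩
  have hT' : ∀ t : T, ∃ c ∈ Tuple.box C ρ', ∀ b ∈ Tuple.box C τ, b ∈ D t ↔ c.append b ∈ 𝒯 := by
    intro t
    obtain ⟨c, hc, hcb⟩ := hT (p.append (Coord.equiv t))
    refine ⟨c, hc, fun b hb => Iff.trans ?_ (hcb b hb)⟩
    refine (h (t, b)).trans (Iff.trans ?_ (Formula.realize_rename _ _ _).symm)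
    rw [he]
    rfl
  have h𝒯d := definable_iff_defPred.1 h𝒯.definable
  -- Over each code `c` for `D t`, the fiber of `X` is a copy of the part of `D t` in the box. The
  -- axioms (F1) and (F2) for the projection of `X` to the codes then give finiteness and
  -- definability.
  let X : Set (Tuple M (ρ' ++ τ)) := {z | z ∈ Tuple.box C (ρ' ++ τ) ∧ z ∈ 𝒯}
  have hX : X ∈ defClass L S₀ C (ρ' ++ τ) :=
    H.sep_mem (fun s hs => (List.mem_append.1 hs).elim (hρ' s) (hτ s)) h𝒯d
  have hf : DefMap L fun z : Tuple M (ρ' ++ τ) => z.split.1 := by fun_prop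
  have hXY : Set.MapsTo (fun z : Tuple M (ρ' ++ τ) => z.split.1) X (Tuple.box C ρ') := by
    intro z hz
    have := hz.1
    rw [← Tuple.append_split z, Tuple.append_mem_box] at this
    exact this.1
  have hfin := H.fubini.finite_image (fun h => h.2.2) hX (H.box_mem hρ') hf hXY
  have hlev := H.fubini.definable_level (fun h => h.2.2) hX (H.box_mem hρ') hf hXY
  have hfib : ∀ c ∈ Tuple.box C ρ', ∀ t, (∀ b ∈ Tuple.box C τ, b ∈ D t ↔ c.append b ∈ 𝒯) →
      μ τ {b | b ∈ Tuple.box C τ ∧ b ∈ D t} =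
        μ (ρ' ++ τ) (X ∩ {z | z.split.1 = c}) := by
    intro c hc t hct
    refine H.eq_of_bijOn (H.sep_mem hτ (DefFam.apply ⟨ρ, p, φ, h⟩ t)) (subset_mem hX
      Set.inter_subset_left (DefPred.and (definable_iff_defPred.1 hX.2.2) (.eq hf (.const c))))
      (f := fun b => c.append b) (by fun_prop) ⟨?_, ?_, ?_⟩
    · rintro b ⟨hb, hbt⟩
      exact ⟨⟨Tuple.append_mem_box.2 ⟨hc, hb⟩, (hct b hb).1 hbt⟩, by simp⟩
    · exact fun b _ b' _ e => (Tuple.append_injective e).2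
    · rintro z ⟨⟨hz, hz𝒯⟩, rfl⟩
      rw [← Tuple.append_split z, Tuple.append_mem_box] at hz
      refine ⟨z.split.2, ⟨hz.2, (hct _ hz.2).2 (by simpa using hz𝒯)⟩, Tuple.append_split z⟩
  refine ⟨hfin.subset ?_, fun a => ?_⟩
  · rintro _ ⟨t, rfl⟩
    obtain ⟨c, hc, hct⟩ := hT' t
    exact ⟨c, hc, (hfib c hc t hct).symm⟩
  · have hD : DefFam L D := ⟨ρ, p, φ, h⟩
    -- Codes need not be unique or depend definably on `t` through a function; it suffices to
    -- quantify over the definable set of codes of `D t`.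
    refine DefPred.congr (P := fun t => ∃ c : Tuple M ρ',
      c ∈ {b | b ∈ Tuple.box C ρ' ∧ μ (ρ' ++ τ) (X ∩ {a | a.split.1 = b}) = a} ∧
        ∀ b : Tuple M τ, b ∈ Tuple.box C τ → (b ∈ D t ↔ c.append b ∈ 𝒯))
      (.ex (.and ((definable_iff_defPred.1 (hlev a)).comp (by fun_prop)) (.all (.imp
        ((defPred_box H.zeroDefinable hτ).comp (by fun_prop)) (.iff
        (hD.mem (f := fun x : (T × Tuple M ρ') × Tuple M τ => x.1.1) (by fun_prop) (by fun_prop))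
        (h𝒯d.comp (by fun_prop)))))))
      fun t => ⟨fun ha => ?_, ?_⟩
    · obtain ⟨c, hc, hct⟩ := hT' t
      exact ⟨c, ⟨hc, (hfib c hc t hct).symm.trans ha⟩, hct⟩
    · rintro ⟨c, ⟨hc, hca⟩, hct⟩
      exact (hfib c hc t hct).trans hca

theorem integral_section_eq_sum {h : T × Tuple M τ → A} (hh : Simple L h) (t : T) :
    integral C μ τ (fun b => h (t, b)) =
      ∑ a ∈ hh.1.toFinset, a * μ τ {b | b ∈ Tuple.box C τ ∧ h (t, b) = a} := by
  refine H.integral_eq_sum hτ (k := fun b => h (t, b)) (hh.comp (by fun_prop)) (fun b _ => ?_)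
    fun a => a
  simp

theorem simple_integral {h : T × Tuple M τ → A} (hh : Simple L h) :
    Simple L fun t => integral C μ τ fun b => h (t, b) := by
  simp only [H.integral_section_eq_sum hτ hh]
  exact Simple.finset_sum _ fun a => (H.simple_section hτ (D := fun t => {b | h (t, b) = a})
    (hh.2 a)).map fun m => a * m

include hτ'

/-- Both sides compute the measure of one subset of a product box, the left one by integrating along
the first projection. -/
theorem integral_section {D : Tuple M τ → Set (Tuple M τ')} (hD : DefFam L D) :
    integral C μ τ (fun b => μ τ' {b' | b' ∈ Tuple.box C τ' ∧ b' ∈ D b}) =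
      μ (τ ++ τ') {z | z ∈ Tuple.box C (τ ++ τ') ∧ z.split.2 ∈ D z.split.1} := by
  have hX : {z | z ∈ Tuple.box C (τ ++ τ') ∧ z.split.2 ∈ D z.split.1} ∈
      defClass L S₀ C (τ ++ τ') :=
    H.sep_mem (fun s hs => (List.mem_append.1 hs).elim (hτ s) (hτ' s))
      (hD.mem (by fun_prop) (by fun_prop))
  have hf : DefMap L fun z : Tuple M (τ ++ τ') => z.split.1 := by fun_prop
  rw [H.fubini.eq_finsum (fun h => h.2.2) subset_mem hX (H.box_mem hτ) hf]
  · refine integral_congr fun b hb => ?_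
    refine H.eq_of_bijOn (H.sep_mem hτ' (hD.apply b)) (subset_mem hX Set.inter_subset_left
      (DefPred.and (definable_iff_defPred.1 hX.2.2) (.eq hf (.const b)))) (f := fun b' => b.append b') (by fun_prop)
      ⟨?_, ?_, ?_⟩
    · rintro b' ⟨hb', hD⟩
      exact ⟨⟨Tuple.append_mem_box.2 ⟨hb, hb'⟩, by simpa using hD⟩, by simp⟩
    · exact fun _ _ _ _ e => (Tuple.append_injective e).2
    · rintro z ⟨⟨hz, hzD⟩, rfl⟩
      rw [← Tuple.append_split z, Tuple.append_mem_box] at hz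
      exact ⟨z.split.2, ⟨hz.2, hzD⟩, Tuple.append_split z⟩
  · intro z hz
    have := hz.1
    rw [← Tuple.append_split z, Tuple.append_mem_box] at this
    exact this.1

theorem integral_integral {h : Tuple M τ × Tuple M τ' → A} (hh : Simple L h) :
    integral C μ τ (fun b => integral C μ τ' fun b' => h (b, b')) =
      ∑ a ∈ hh.1.toFinset,
        a * μ (τ ++ τ') {z | z ∈ Tuple.box C (τ ++ τ') ∧ h z.split = a} := by
  simp only [H.integral_section_eq_sum hτ' hh]
  have hs : ∀ a, Simple L fun b => μ τ' {b' | b' ∈ Tuple.box C τ' ∧ h (b, b') = a} := fun a =>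
    H.simple_section hτ' (D := fun b => {b' | h (b, b') = a}) (hh.2 a)
  rw [H.integral_finset_sum hτ _ fun a => (hs a).map fun m => a * m]
  refine Finset.sum_congr rfl fun a _ => ?_
  rw [H.integral_const_mul hτ (hs a)]
  congr 1
  exact H.integral_section hτ hτ' (D := fun b => {b' | h (b, b') = a}) (hh.2 a)

/-- By `integral_integral` both iterated integrals are sums over level sets in a product box, and
exchanging the factors is a measure-preserving bijection. -/
theorem integral_swap {h : Tuple M τ × Tuple M τ' → A} (hh : Simple L h) :
    integral C μ τ (fun b => integral C μ τ' fun b' => h (b, b')) =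
      integral C μ τ' fun b' => integral C μ τ fun b => h (b, b') := by
  have hh' : Simple L fun z : Tuple M τ' × Tuple M τ => h (z.2, z.1) := hh.comp (by fun_prop)
  rw [H.integral_integral hτ hτ' hh, H.integral_integral hτ' hτ hh']
  have hr : hh.1.toFinset = hh'.1.toFinset := by
    ext a
    simp only [Set.Finite.mem_toFinset, Set.mem_range, Prod.exists]
    exact exists_comm
  rw [hr]
  refine Finset.sum_congr rfl fun a _ => ?_
  congr 1
  refine H.eq_of_bijOn
    (H.sep_mem (fun s hs => (List.mem_append.1 hs).elim (hτ s) (hτ' s)) ((hh.2 a).comp (by fun_prop)))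
    (H.sep_mem (fun s hs => (List.mem_append.1 hs).elim (hτ' s) (hτ s)) ((hh'.2 a).comp (by fun_prop)))
    (f := fun z => z.split.2.append z.split.1) (by fun_prop) ⟨?_, ?_, ?_⟩
  · rintro z ⟨hz, hza⟩
    rw [← Tuple.append_split z, Tuple.append_mem_box] at hz
    exact ⟨Tuple.append_mem_box.2 hz.symm, by simpa using hza⟩
  · intro z _ z' _ e
    obtain ⟨h1, h2⟩ := Tuple.append_injective e
    rw [← Tuple.append_split z, ← Tuple.append_split z', h1, h2]
  · rintro z ⟨hz, hza⟩
    rw [← Tuple.append_split z, Tuple.append_mem_box] at hz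
    exact ⟨z.split.2.append z.split.1, ⟨Tuple.append_mem_box.2 hz.symm, by simpa using hza⟩,
      by simp⟩

end StableFubini

end Integral

/-! ### Construction, Fubini property and uniqueness of the extension. -/

section Extension

variable {S : Type u} {L : MSLanguage.{u, v, v'} S} {M : S → Type w} [LStructure L M]
variable {A : Type x} [CommSemiring A] {S₀ : Set S} {C : ∀ s, Set (M s)}
variable {μ : ∀ σ : List S, Set (Tuple M σ) → A}

variable (L S₀ C μ) in
/-- Functions on a collection of sets that are computed by integrating along definable maps into
products of the sets `C s`. -/
structure IsIntegrating {σ : List S} (𝒳 : Set (Set (Tuple M σ))) (m : Set (Tuple M σ) → A) :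
    Prop where
  empty : m ∅ = 0
  singleton : ∀ a, {a} ∈ 𝒳 → m {a} = 1
  eq_integral : ∀ X ∈ 𝒳, Definable L X → ∀ τ : List S, (∀ s ∈ τ, s ∈ S₀) →
    ∀ f : Tuple M σ → Tuple M τ, DefMap L f → Set.MapsTo f X (Tuple.box C τ) →
      m X = integral C μ τ fun b => m (X ∩ {a | f a = b})

variable (L) in
/-- Functions that are simple along all definable families of sets. -/
def IsUniform {σ : List S} (m : Set (Tuple M σ) → A) : Prop :=
  ∀ {T : Type w} [Coord M T] {Z : T → Set (Tuple M σ)}, DefFam L Z → Simple L fun t => m (Z t)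

theorem DefFam.inter_level {σ τ : List S} {X : Set (Tuple M σ)} (hX : Definable L X)
    {f : Tuple M σ → Tuple M τ} (hf : DefMap L f) : DefFam L fun b => X ∩ {a | f a = b} :=
  DefFam.inter (.const hX) (DefPred.eq (f := fun x : Tuple M τ × Tuple M σ => f x.2)
    (g := fun x => x.1) (by fun_prop) (by fun_prop))

/-- Both functions are integrals of their values on the fibers of the same map, so agreement
descends to subsingletons. The auxiliary `𝒵` allows a comparison of functions that are integrating
only on different collections. -/
theorem Fib.eq_of_isIntegrating {σ : List S} {𝒳 : Set (Set (Tuple M σ))} (h𝒳 : Fib L S₀ C 𝒳)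
    {𝒵 : Set (Set (Tuple M σ))} (h𝒵 : ∀ X ∈ 𝒵, ∀ Y ⊆ X, Definable L Y → Y ∈ 𝒵)
    {m m' : Set (Tuple M σ) → A} (hm : IsIntegrating L S₀ C μ 𝒵 m)
    (hm' : IsIntegrating L S₀ C μ 𝒵 m') :
    ∀ X ∈ 𝒳, X ∈ 𝒵 → Definable L X → m X = m' X := by
  induction h𝒳 with
  | base =>
    intro X hX hXZ _
    rcases Set.Subsingleton.eq_empty_or_singleton hX with rfl | ⟨a, rfl⟩
    · rw [hm.empty, hm'.empty]
    · rw [hm.singleton a hXZ, hm'.singleton a hXZ]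
  | step hπ hτ f hf hfC h ih =>
    rintro X ⟨p, hp⟩ hXZ hXd
    have hfp : DefMap L fun a => f (p, a) := by fun_prop
    have hC : Set.MapsTo (fun a => f (p, a)) X (Tuple.box C _) := fun a _ => hfC _
    rw [hm.eq_integral X hXZ hXd _ hτ _ hfp hC, hm'.eq_integral X hXZ hXd _ hτ _ hfp hC]
    refine integral_congr fun b _ => ?_
    have hd := (DefFam.inter_level hXd hfp).apply_defPred b
    exact ih h𝒵 hm hm' _ (hp b) (h𝒵 _ hXZ _ Set.inter_subset_left hd) hd

namespace StableFubini

variable (H : StableFubini L S₀ C μ)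
include H

/-- The value is 1 on nonempty sets and 0 on the empty set. On a singleton, integrating along `f`
gives the measure of the single point `f a`. -/
theorem exists_base (σ : List S) : ∃ m : Set (Tuple M σ) → A,
    IsIntegrating L S₀ C μ {X : Set (Tuple M σ) | X.Subsingleton} m ∧ IsUniform L m := by
  classical
  refine ⟨fun X => if X = ∅ then 0 else 1, ⟨by simp, fun a _ => by simp, ?_⟩, ?_⟩
  · intro X hX _ τ hτ f hf hfX
    rcases Set.Subsingleton.eq_empty_or_singleton hX with rfl | ⟨a, rfl⟩
    · simp [H.integral_zero hτ]
    · have hb : ∀ b, ({a} ∩ {a' | f a' = b} = ∅) ↔ ¬ b = f a := by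
        intro b
        rw [Set.eq_empty_iff_forall_notMem]
        exact ⟨fun h e => h a ⟨rfl, e.symm⟩, by rintro h a' ⟨rfl, h'⟩; exact h h'.symm⟩
      simp only [hb, ite_not, Set.singleton_ne_empty, if_false]
      have hP : DefPred L fun b => b = f a := .eq .id (.const _)
      rw [H.integral_indicator hτ hP]
      have h : {b | b ∈ Tuple.box C τ ∧ b = f a} = {f a} := by
        ext b
        exact ⟨fun h => h.2, fun h => ⟨h ▸ hfX rfl, h⟩⟩
      rw [h]
      refine (H.fubini.singleton τ (f a) ?_).symm
      rw [← h]
      exact H.sep_mem hτ hP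
  · intro T _ Z hZ
    refine (Simple.of_defPred (P := fun t => Z t = ∅) ?_).map fun Q => if Q then 0 else 1
    exact DefPred.congr (.not (.ex hZ)) fun t => by
      rw [← Set.not_nonempty_iff_eq_empty]
      rfl

/-- The new value integrates the old one along `f (p, -)`. Since every fiber lies in `𝒴`, where `m`
may be disintegrated along any further map, integrals along two maps can be compared through their
common refinement. -/
theorem exists_step {π σ τ : List S} (hτ : ∀ s ∈ τ, s ∈ S₀)
    {f : Tuple M π × Tuple M σ → Tuple M τ} (hf : DefMap L f) (hfC : ∀ z, f z ∈ Tuple.box C τ)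
    {𝒴 : Set (Set (Tuple M σ))} (h𝒴 : Fib L S₀ C 𝒴) {m : Set (Tuple M σ) → A}
    (hm : IsIntegrating L S₀ C μ 𝒴 m) (hmu : IsUniform L m) : ∃ m' : Set (Tuple M σ) → A,
      IsIntegrating L S₀ C μ {X | ∃ p, ∀ b, X ∩ {a | f (p, a) = b} ∈ 𝒴} m' ∧ IsUniform L m' := by
  classical
  have hfp : ∀ p, DefMap L fun a => f (p, a) := fun p => by fun_prop
  have hsum : ∀ {X : Set (Tuple M σ)} {p : Tuple M π}, Definable L X →
      (∀ b, X ∩ {a | f (p, a) = b} ∈ 𝒴) → ∀ {τ' : List S}, (∀ s ∈ τ', s ∈ S₀) →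
      ∀ {g : Tuple M σ → Tuple M τ'}, DefMap L g → Set.MapsTo g X (Tuple.box C τ') →
      integral C μ τ (fun b => m (X ∩ {a | f (p, a) = b})) =
        integral C μ τ' fun b' => integral C μ τ fun b =>
          m (X ∩ {a | g a = b'} ∩ {a | f (p, a) = b}) := by
    intro X p hX hp τ' hτ' g hg hgX
    have hs : Simple L fun z : Tuple M τ' × Tuple M τ =>
        m (X ∩ {a | g a = z.1} ∩ {a | f (p, a) = z.2}) := by
      refine hmu (((DefFam.inter_level hX hg).comp DefMap.fst).inter ?_)
      exact DefPred.eq (f := fun x : (Tuple M τ' × Tuple M τ) × Tuple M σ => f (p, x.2))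
        (g := fun x => x.1.2) (by fun_prop) (by fun_prop)
    -- With `b` outermost, the inner integral over `b'` disintegrates along `g` a fiber belonging to
    -- `𝒴`, and collapses by `eq_integral`.
    rw [H.integral_swap hτ' hτ hs]
    refine integral_congr fun b _ => ?_
    rw [hm.eq_integral _ (hp b) ((DefFam.inter_level hX (hfp p)).apply_defPred b) τ' hτ' g hg
      fun a ha => hgX ha.1]
    simp only [Set.inter_right_comm]
  -- Uniformity is required along all definable families, including members outside the collection,
  -- so these get the value 0.
  let m' : Set (Tuple M σ) → A := fun X =>
    if h : ∃ p, ∀ b, X ∩ {a | f (p, a) = b} ∈ 𝒴 then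
      integral C μ τ fun b => m (X ∩ {a | f (h.choose, a) = b}) else 0
  have hm' : ∀ {X : Set (Tuple M σ)} {p : Tuple M π}, Definable L X →
      (∀ b, X ∩ {a | f (p, a) = b} ∈ 𝒴) →
      m' X = integral C μ τ fun b => m (X ∩ {a | f (p, a) = b}) := by
    intro X p hX hp
    have h : ∃ p, ∀ b, X ∩ {a | f (p, a) = b} ∈ 𝒴 := ⟨p, hp⟩
    simp only [m', dif_pos h]
    -- Independence of `p`: the integral along `f (p, -)` is disintegrated along the chosen map, and
    -- for each value `b` of the latter the inner integral is the value of `m` on its fiber.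
    rw [hsum hX hp hτ (hfp h.choose) fun a _ => hfC _]
    refine integral_congr fun b _ => ?_
    rw [hm.eq_integral _ (h.choose_spec b)
      ((DefFam.inter_level hX (hfp h.choose)).apply_defPred b) τ hτ _ (hfp p) fun a _ => hfC _]
  have hm'0 : ∀ {X : Set (Tuple M σ)}, (¬ ∃ p, ∀ b, X ∩ {a | f (p, a) = b} ∈ 𝒴) → m' X = 0 :=
    fun h => by simp only [m', dif_neg h]
  refine ⟨m', ⟨?_, ?_, ?_⟩, ?_⟩
  · by_cases h : ∃ p, ∀ b, (∅ : Set (Tuple M σ)) ∩ {a | f (p, a) = b} ∈ 𝒴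
    · obtain ⟨p, hp⟩ := h
      rw [hm' (X := ∅) (DefPred.false (T := Tuple M σ)) hp]
      simp only [Set.empty_inter, hm.empty, H.integral_zero hτ]
    · exact hm'0 h
  · rintro a ⟨p, hp⟩
    rw [hm' (X := {a}) (DefPred.eq (T := Tuple M σ) .id (.const a)) hp]
    have ha : {a} ∩ {a' | f (p, a') = f (p, a)} = {a} :=
      Set.inter_eq_left.2 (Set.singleton_subset_iff.2 rfl)
    have hP : DefPred L fun b => b = f (p, a) := .eq .id (.const _)
    have h1 : ∀ b, m ({a} ∩ {a' | f (p, a') = b}) = if b = f (p, a) then 1 else 0 := by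
      intro b
      split_ifs with h
      · rw [h, ha]
        exact hm.singleton a (ha ▸ hp _)
      · have he : {a} ∩ {a' | f (p, a') = b} = ∅ :=
          Set.singleton_inter_eq_empty.2 fun h' => h (Eq.symm h')
        rw [he, hm.empty]
    simp only [h1]
    rw [H.integral_indicator hτ hP]
    have h : {b | b ∈ Tuple.box C τ ∧ b = f (p, a)} = {f (p, a)} := by
      ext b
      exact ⟨fun h => h.2, fun h => ⟨h ▸ hfC _, h⟩⟩
    rw [h]
    refine H.fubini.singleton τ (f (p, a)) ?_
    rw [← h]
    exact H.sep_mem hτ hP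
  · rintro X ⟨p, hp⟩ hX τ' hτ' g hg hgX
    rw [hm' hX hp, hsum hX hp hτ' hg hgX]
    refine integral_congr fun b' _ => (hm' ((DefFam.inter_level hX hg).apply_defPred b') ?_).symm
    intro b
    exact h𝒴.mono (hp b) (Set.inter_subset_inter_left _ Set.inter_subset_left)
  · intro T _ Z hZ
    have hfam : DefFam L fun z : (T × Tuple M π) × Tuple M τ =>
        Z z.1.1 ∩ {a | f (z.1.2, a) = z.2} :=
      (hZ.comp (f := fun z : (T × Tuple M π) × Tuple M τ => z.1.1) (by fun_prop)).inter
        ((DefFam.preimage hf).comp (f := fun z : (T × Tuple M π) × Tuple M τ => (z.1.2, z.2))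
          (by fun_prop))
    have hgood : DefPred L fun z : T × Tuple M π => ∀ b, Z z.1 ∩ {a | f (z.2, a) = b} ∈ 𝒴 :=
      .all (h𝒴.defPred_mem hfam)
    have hint : Simple L fun z : T × Tuple M π =>
        integral C μ τ fun b => m (Z z.1 ∩ {a | f (z.2, a) = b}) :=
      H.simple_integral hτ (hmu hfam)
    have hval : ∀ t p, (∀ b, Z t ∩ {a | f (p, a) = b} ∈ 𝒴) →
        m' (Z t) = integral C μ τ fun b => m (Z t ∩ {a | f (p, a) = b}) := fun t p hp =>
      hm' (hZ.apply_defPred t) hp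
    refine ⟨(hint.1.insert 0).subset ?_, fun c => ?_⟩
    · rintro _ ⟨t, rfl⟩
      by_cases h : ∃ p, ∀ b, Z t ∩ {a | f (p, a) = b} ∈ 𝒴
      · obtain ⟨p, hp⟩ := h
        exact Or.inr ⟨(t, p), (hval t p hp).symm⟩
      · exact Or.inl (hm'0 h)
    -- As the value does not depend on `p`, the level set is described by quantifying over the
    -- admissible `p`, without choosing one definably.
    · refine DefPred.congr (.or (.ex (P := fun t p => (∀ b, Z t ∩ {a | f (p, a) = b} ∈ 𝒴) ∧
        integral C μ τ (fun b => m (Z t ∩ {a | f (p, a) = b})) = c) (.and hgood (hint.2 c)))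
        (.and (.not (.ex (P := fun t p => ∀ b, Z t ∩ {a | f (p, a) = b} ∈ 𝒴) hgood)) (.const (0 = c)))) fun t =>
        ⟨fun hc => ?_, ?_⟩
      · by_cases h : ∃ p, ∀ b, Z t ∩ {a | f (p, a) = b} ∈ 𝒴
        · obtain ⟨p, hp⟩ := h
          exact Or.inl ⟨p, hp, (hval t p hp).symm.trans hc⟩
        · exact Or.inr ⟨h, (hm'0 h).symm.trans hc⟩
      · rintro (⟨p, hp, hc⟩ | ⟨h, hc⟩)
        · exact (hval t p hp).trans hc
        · exact (hm'0 h).trans hc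

theorem exists_isIntegrating {σ : List S} {𝒳 : Set (Set (Tuple M σ))} (h𝒳 : Fib L S₀ C 𝒳) :
    ∃ m : Set (Tuple M σ) → A, IsIntegrating L S₀ C μ 𝒳 m ∧ IsUniform L m := by
  induction h𝒳 with
  | base => exact H.exists_base _
  | step hπ hτ f hf hfC h ih =>
    obtain ⟨m, hm, hmu⟩ := ih
    exact H.exists_step hτ hf hfC h hm hmu

/-- Cut `Y` by `g (p, -)` and `X` by its composite with `f`. Fibers of `f` over points of a piece of
`Y` are unchanged, so the constant `c` persists and factors out of the integral. Over a single
point, the fiber is all of `X`. -/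
theorem fubini_of_isIntegrating {σ σ' : List S} {𝒳 : Set (Set (Tuple M σ))}
    (h𝒳 : ∀ X ∈ 𝒳, ∀ Y ⊆ X, Definable L Y → Y ∈ 𝒳) {m : Set (Tuple M σ) → A}
    (hm : IsIntegrating L S₀ C μ 𝒳 m) {𝒵 : Set (Set (Tuple M σ'))}
    (h𝒵 : ∀ X ∈ 𝒵, ∀ Y ⊆ X, Definable L Y → Y ∈ 𝒵) {n : Set (Tuple M σ') → A}
    (hn : IsIntegrating L S₀ C μ 𝒵 n) (hnu : IsUniform L n) {f : Tuple M σ → Tuple M σ'}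
    (hf : DefMap L f) (c : A) {𝒴 : Set (Set (Tuple M σ'))} (h𝒴 : Fib L S₀ C 𝒴) :
    ∀ Y ∈ 𝒴, Y ∈ 𝒵 → Definable L Y → ∀ X ∈ 𝒳, Definable L X → Set.MapsTo f X Y →
      (∀ y ∈ Y, m (X ∩ {a | f a = y}) = c) → m X = c * n Y := by
  induction h𝒴 with
  | base =>
    intro Y hY hYZ _ X _ _ hXY hc
    rcases Set.Subsingleton.eq_empty_or_singleton hY with rfl | ⟨y, rfl⟩
    · rw [Set.eq_empty_of_forall_notMem fun x hx => hXY hx, hm.empty, hn.empty, mul_zero]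
    · have hX : X ∩ {a | f a = y} = X := Set.inter_eq_left.2 hXY
      rw [hn.singleton y hYZ, mul_one, ← hc y rfl, hX]
  | @step π σ' τ hπ hτ g hg hgC 𝒴 h ih =>
    rintro Y ⟨p, hp⟩ hYZ hYd X hX𝒳 hXd hXY hc
    have hgp : DefMap L fun y => g (p, y) := by fun_prop
    have hgf : DefMap L fun a => g (p, f a) := by fun_prop
    rw [hm.eq_integral X hX𝒳 hXd τ hτ _ hgf fun a _ => hgC _,
      hn.eq_integral Y hYZ hYd τ hτ _ hgp fun a _ => hgC _,
      ← H.integral_const_mul hτ (hnu (DefFam.inter_level hYd hgp))]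
    refine integral_congr fun b _ => ?_
    have hd := (DefFam.inter_level hYd hgp).apply_defPred b
    have hd' := (DefFam.inter_level hXd hgf).apply_defPred b
    refine ih h𝒵 hn hnu hf _ (hp b) (h𝒵 _ hYZ _ Set.inter_subset_left hd) hd _
      (h𝒳 _ hX𝒳 _ Set.inter_subset_left hd') hd' (fun a ha => ⟨hXY ha.1, ha.2⟩) fun y hy => ?_
    rw [← hc y hy.1]
    congr 1
    ext a
    constructor
    · rintro ⟨h1, h2⟩
      exact ⟨h1.1, h2⟩
    · rintro ⟨h1, rfl⟩
      exact ⟨⟨h1, hy.2⟩, rfl⟩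

/-- Integrate along the map that is `c₀` on `X` and `c₁` elsewhere: on the union its fibers over
`c₀` and `c₁` are `X` and `Y`, all others are empty, and single points of the box have measure 1. -/
theorem add_of_isIntegrating (hC2 : ∃ s ∈ S₀, (C s).Nontrivial) {σ : List S}
    {𝒳 : Set (Set (Tuple M σ))} {m : Set (Tuple M σ) → A} (hm : IsIntegrating L S₀ C μ 𝒳 m)
    {X Y : Set (Tuple M σ)} (hXY : X ∪ Y ∈ 𝒳) (hX : Definable L X) (hY : Definable L Y)
    (hdisj : Disjoint X Y) : m (X ∪ Y) = m X + m Y := by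
  classical
  obtain ⟨s, hs, c₀, hc₀, c₁, hc₁, hne⟩ := hC2
  have hs' : ∀ t ∈ [s], t ∈ S₀ := by simpa using hs
  let d₀ : Tuple M [s] := (c₀, PUnit.unit)
  let d₁ : Tuple M [s] := (c₁, PUnit.unit)
  have hd₀ : d₀ ∈ Tuple.box C [s] := ⟨hc₀, trivial⟩
  have hd₁ : d₁ ∈ Tuple.box C [s] := ⟨hc₁, trivial⟩
  have hd : d₀ ≠ d₁ := fun h => hne (congrArg Prod.fst h)
  have hf : DefMap L fun a => if a ∈ X then d₀ else d₁ :=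
    .ite (definable_iff_defPred.1 hX) (.const _) (.const _)
  rw [hm.eq_integral _ hXY (DefPred.or (definable_iff_defPred.1 hX) (definable_iff_defPred.1 hY))
    [s] hs' _ hf fun a _ => by split_ifs <;> assumption]
  have hval : ∀ b, m ((X ∪ Y) ∩ {a | (if a ∈ X then d₀ else d₁) = b}) =
      m X * (if b = d₀ then 1 else 0) + m Y * (if b = d₁ then 1 else 0) := by
    intro b
    by_cases h0 : b = d₀
    · have h : (X ∪ Y) ∩ {a | (if a ∈ X then d₀ else d₁) = b} = X := by
        ext a
        by_cases ha : a ∈ X <;> simp [ha, h0, hd.symm]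
      rw [h]
      simp [h0, hd]
    by_cases h1 : b = d₁
    · have h : (X ∪ Y) ∩ {a | (if a ∈ X then d₀ else d₁) = b} = Y := by
        ext a
        by_cases ha : a ∈ X
        · simp [ha, h1, hd, Set.disjoint_left.1 hdisj ha]
        · simp [ha, h1]
      rw [h]
      simp [h1, hd.symm]
    · have h : (X ∪ Y) ∩ {a | (if a ∈ X then d₀ else d₁) = b} = ∅ := by
        ext a
        by_cases ha : a ∈ X <;> simp [ha, Ne.symm h0, Ne.symm h1]
      rw [h, hm.empty]
      simp [h0, h1]
  have hP : ∀ d, DefPred L fun b : Tuple M [s] => b = d := fun d => .eq .id (.const _)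
  have hI : ∀ d, Simple L fun b : Tuple M [s] => (if b = d then 1 else 0 : A) := fun d =>
    (Simple.of_defPred (hP d)).map fun Q => if Q then 1 else 0
  have hμ : ∀ d ∈ Tuple.box C [s],
      integral C μ [s] (fun b : Tuple M [s] => (if b = d then 1 else 0 : A)) = 1 := by
    intro d hd
    have h : {b | b ∈ Tuple.box C [s] ∧ b = d} = {d} := by
      ext b
      exact ⟨fun h => h.2, fun h => ⟨h ▸ hd, h⟩⟩
    rw [H.integral_indicator hs' (hP d), h]
    refine H.fubini.singleton [s] d ?_
    rw [← h]
    exact H.sep_mem hs' (hP d)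
  simp only [hval]
  rw [H.integral_add hs' ((hI d₀).map fun c => m X * c) ((hI d₁).map fun c => m Y * c),
    H.integral_const_mul hs' (hI d₀), H.integral_const_mul hs' (hI d₁), hμ d₀ hd₀, hμ d₁ hd₁,
    mul_one, mul_one]

omit H in
open Classical in
variable (L S₀ C μ) in
/-- The extension of a Fubini measure to the fiberable sets. -/
noncomputable def extension (σ : List S) (X : Set (Tuple M σ)) : A :=
  if h : ∃ m : Set (Tuple M σ) → A, ∃ 𝒳, Fib L S₀ C 𝒳 ∧ X ∈ 𝒳 ∧ IsIntegrating L S₀ C μ 𝒳 m then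
    h.choose X else 0

-- The choices in `extension` do not matter: `m` and the chosen function are both integrating on the
-- intersection of their collections, hence agree at `X`.
omit H in
theorem extension_eq {σ : List S} {𝒳 : Set (Set (Tuple M σ))} (h𝒳 : Fib L S₀ C 𝒳)
    {m : Set (Tuple M σ) → A} (hm : IsIntegrating L S₀ C μ 𝒳 m) {X : Set (Tuple M σ)}
    (hX : X ∈ 𝒳) (hXd : Definable L X) : extension L S₀ C μ σ X = m X := by
  have h : ∃ m : Set (Tuple M σ) → A, ∃ 𝒳, Fib L S₀ C 𝒳 ∧ X ∈ 𝒳 ∧ IsIntegrating L S₀ C μ 𝒳 m :=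
    ⟨m, 𝒳, h𝒳, hX, hm⟩
  rw [extension, dif_pos h]
  obtain ⟨𝒴, h𝒴, hX𝒴, hm'⟩ := h.choose_spec
  refine h𝒳.eq_of_isIntegrating (𝒵 := 𝒳 ∩ 𝒴)
    (fun X hX Y hY _ => ⟨h𝒳.mono hX.1 hY, h𝒴.mono hX.2 hY⟩)
    ⟨hm'.empty, fun a ha => hm'.singleton a ha.2, fun X hX => hm'.eq_integral X hX.2⟩
    ⟨hm.empty, fun a ha => hm.singleton a ha.1, fun X hX => hm.eq_integral X hX.1⟩ X hX ⟨hX, hX𝒴⟩ hXd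

/-- One integrating and uniform function represents the extension on all definable subsets of `X` at
once, in particular on all fibers of a definable map from `X`. -/
theorem exists_extension_eq {σ : List S} {X : Set (Tuple M σ)}
    (hX : X ∈ fiberableClass L S₀ C σ) : ∃ 𝒳, Fib L S₀ C 𝒳 ∧ X ∈ 𝒳 ∧
      ∃ m : Set (Tuple M σ) → A, IsIntegrating L S₀ C μ 𝒳 m ∧ IsUniform L m ∧
        ∀ Y ⊆ X, Definable L Y → extension L S₀ C μ σ Y = m Y := by
  obtain ⟨-, 𝒳, h𝒳, hX⟩ := (mem_fiberableClass_iff H.nonempty H.zeroDefinable).1 hX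
  obtain ⟨m, hm, hmu⟩ := H.exists_isIntegrating h𝒳
  exact ⟨𝒳, h𝒳, hX, m, hm, hmu, fun Y hY hYd => extension_eq h𝒳 hm (h𝒳.mono hX hY) hYd⟩

-- Morphisms are given on `X` only, whereas the calculus works with total maps; a point of `Y`
-- serves as value off `X`.
omit H in
theorem exists_total {σ τ : List S} {X : Set (Tuple M σ)} {Y : Set (Tuple M τ)} (hX : Definable L X)
    (f : X → Y) (hf : Definable L (graph f)) (hY : Y.Nonempty) :
    ∃ F : Tuple M σ → Tuple M τ, DefMap L F ∧ Set.MapsTo F X Y ∧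
      ∀ b : Y, fiber f b = X ∩ {a | F a = b} := by
  classical
  obtain ⟨y₀, hy₀⟩ := hY
  let F : Tuple M σ → Tuple M τ := fun a => if h : a ∈ X then f ⟨a, h⟩ else y₀
  have hF : ∀ a : X, F a = f a := fun a => by simp only [F, dif_pos a.2]
  refine ⟨F, ?_, fun a ha => ?_, fun b => ?_⟩
  · refine DefPred.congr (P := fun x : Tuple M σ × Tuple M τ =>
      x.1.append x.2 ∈ graph f ∨ (x.1 ∉ X ∧ x.2 = y₀))
      (.or ((definable_iff_defPred.1 hf).comp (by fun_prop))
        (.and (.not ((definable_iff_defPred.1 hX).comp (by fun_prop)))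
          (.eq (by fun_prop) (by fun_prop)))) ?_
    rintro ⟨a, b⟩
    change F a = b ↔ (∃ a' : X, a'.1.append (f a').1 = a.append b) ∨ (a ∉ X ∧ b = y₀)
    constructor
    · rintro rfl
      by_cases h : a ∈ X
      · exact Or.inl ⟨⟨a, h⟩, by rw [← hF ⟨a, h⟩]⟩
      · exact Or.inr ⟨h, by simp only [F, dif_neg h]⟩
    · rintro (⟨a', h⟩ | ⟨h, rfl⟩)
      · obtain ⟨rfl, rfl⟩ := Tuple.append_injective h
        exact hF a'
      · simp only [F, dif_neg h]
  · rw [hF ⟨a, ha⟩]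
    exact (f ⟨a, ha⟩).2
  · ext a
    constructor
    · rintro ⟨a, ha, rfl⟩
      exact ⟨a.2, (hF a).trans (congrArg Subtype.val ha)⟩
    · rintro ⟨ha, hb⟩
      exact ⟨⟨a, ha⟩, Subtype.ext ((hF ⟨a, ha⟩).symm.trans hb), rfl⟩

theorem isFubiniMeasure_extension (hC2 : ∃ s ∈ S₀, (C s).Nontrivial) :
    IsFubiniMeasure L (fiberableClass L S₀ C) (extension L S₀ C μ) where
  empty σ h := by
    obtain ⟨𝒳, h𝒳, hX, m, hm, -, he⟩ := H.exists_extension_eq h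
    rw [he _ subset_rfl h.1, hm.empty]
  singleton σ a h := by
    obtain ⟨𝒳, h𝒳, hX, m, hm, -, he⟩ := H.exists_extension_eq h
    rw [he _ subset_rfl h.1, hm.singleton a hX]
  union σ X Y hX hY hdisj := by
    have h := (isClosedClass_fiberableClass H.nonempty H.zeroDefinable hC2).union hX hY
    obtain ⟨𝒳, h𝒳, hXY, m, hm, -, he⟩ := H.exists_extension_eq h
    rw [he _ subset_rfl h.1, he X Set.subset_union_left hX.1, he Y Set.subset_union_right hY.1,
      H.add_of_isIntegrating hC2 hm hXY hX.1 hY.1 hdisj]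
  finite σ τ X Y hX hY f hf := by
    rcases Y.eq_empty_or_nonempty with rfl | hne
    · exact Set.toFinite _
    obtain ⟨F, hF, -, hfib⟩ := exists_total hX.1 f hf hne
    obtain ⟨𝒳, h𝒳, -, m, hm, hmu, he⟩ := H.exists_extension_eq hX
    have hfam := DefFam.inter_level hX.1 hF
    refine (hmu hfam).1.subset ?_
    rintro _ ⟨b, rfl⟩
    refine ⟨b, ?_⟩
    dsimp only
    rw [hfib, he _ Set.inter_subset_left (hfam.apply_defPred b.1)]
  definable σ τ X Y hX hY f hf c := by
    rcases Y.eq_empty_or_nonempty with rfl | hne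
    · refine DefPred.congr (T := Tuple M τ) .false fun b => ⟨?_, False.elim⟩
      rintro ⟨b, -⟩
      exact b.2
    obtain ⟨F, hF, -, hfib⟩ := exists_total hX.1 f hf hne
    obtain ⟨𝒳, h𝒳, -, m, hm, hmu, he⟩ := H.exists_extension_eq hX
    have hfam := DefFam.inter_level hX.1 hF
    have hval : ∀ b : Y, extension L S₀ C μ σ (fiber f b) = m (X ∩ {a | F a = b}) := fun b => by
      rw [hfib, he _ Set.inter_subset_left (hfam.apply_defPred b.1)]
    refine DefPred.congr (.and (definable_iff_defPred.1 hY.1) ((hmu hfam).2 c)) fun b => ⟨?_, ?_⟩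
    · rintro ⟨b, hb, rfl⟩
      exact ⟨b.2, (hval b).symm.trans hb⟩
    · rintro ⟨hb, hc⟩
      exact ⟨⟨b, hb⟩, (hval ⟨b, hb⟩).trans hc, rfl⟩
  fubini σ τ X Y hX hY f hf c hc := by
    obtain ⟨𝒳, h𝒳, hX𝒳, m, hm, -, he⟩ := H.exists_extension_eq hX
    obtain ⟨𝒴, h𝒴, hY𝒴, n, hn, hnu, he'⟩ := H.exists_extension_eq hY
    rw [he X subset_rfl hX.1, he' Y subset_rfl hY.1]
    rcases Y.eq_empty_or_nonempty with rfl | hne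
    · rw [Set.eq_empty_of_forall_notMem fun x hx => (f ⟨x, hx⟩).2, hm.empty, hn.empty, mul_zero]
    obtain ⟨F, hF, hFXY, hfib⟩ := exists_total hX.1 f hf hne
    refine H.fubini_of_isIntegrating (fun X hX Y hY _ => h𝒳.mono hX hY) hm
      (fun X hX Y hY _ => h𝒴.mono hX hY) hn hnu hF c h𝒴 Y hY𝒴 hY𝒴 hY.1 X hX𝒳 hX.1 hFXY
      fun y hy => ?_
    rw [← hc ⟨y, hy⟩, hfib, he _ Set.inter_subset_left
      ((DefFam.inter_level hX.1 hF).apply_defPred y)]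

/-- Integrate along the identity: the fibers are points or empty, so the integrand is the indicator
function of `X`. -/
theorem extension_eq_of_mem_defClass {σ : List S} {X : Set (Tuple M σ)}
    (hX : X ∈ defClass L S₀ C σ) : extension L S₀ C μ σ X = μ σ X := by
  classical
  obtain ⟨𝒳, h𝒳, hX𝒳, m, hm, -, he⟩ :=
    H.exists_extension_eq (defClass_subset_fiberableClass H.nonempty H.zeroDefinable σ hX)
  rw [he X subset_rfl hX.2.2,
    hm.eq_integral X hX𝒳 hX.2.2 σ hX.1 (fun a => a) (by fun_prop) fun a ha => hX.2.1 ha]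
  have h : ∀ b, m (X ∩ {a | a = b}) = if b ∈ X then 1 else 0 := by
    intro b
    split_ifs with hb
    · have : X ∩ {a | a = b} = {b} := Set.inter_eq_right.2 (Set.singleton_subset_iff.2 hb)
      rw [this, hm.singleton b (h𝒳.mono hX𝒳 (Set.singleton_subset_iff.2 hb))]
    · have : X ∩ {a | a = b} = ∅ := Set.inter_singleton_eq_empty.2 hb
      rw [this, hm.empty]
  simp only [h]
  rw [H.integral_indicator hX.1 (definable_iff_defPred.1 hX.2.2)]
  congr 1
  exact Set.inter_eq_right.2 hX.2.1

/-- Any such `ν` is integrating: `eq_finsum` along a map into a box involves measures of subsets of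
the box, on which `ν` equals `μ`. -/
theorem extension_unique (hC2 : ∃ s ∈ S₀, (C s).Nontrivial)
    {ν : ∀ σ : List S, Set (Tuple M σ) → A} (hν : IsFubiniMeasure L (fiberableClass L S₀ C) ν)
    (hμ : ∀ σ, ∀ X ∈ defClass L S₀ C σ, ν σ X = μ σ X) {σ : List S} {X : Set (Tuple M σ)}
    (hX : X ∈ fiberableClass L S₀ C σ) : ν σ X = extension L S₀ C μ σ X := by
  have hcl := isClosedClass_fiberableClass H.nonempty H.zeroDefinable hC2
  obtain ⟨𝒳, h𝒳, hX𝒳, m, hm, -, he⟩ := H.exists_extension_eq hX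
  rw [he X subset_rfl hX.1]
  have hsub : ∀ {σ : List S} {X Y : Set (Tuple M σ)}, X ∈ fiberableClass L S₀ C σ → Y ⊆ X →
      Definable L Y → Y ∈ fiberableClass L S₀ C σ := fun h h' h'' => hcl.subset h h' h''
  refine h𝒳.eq_of_isIntegrating (𝒵 := 𝒳 ∩ fiberableClass L S₀ C σ)
    (fun X hX Y hY hYd => ⟨h𝒳.mono hX.1 hY, hsub hX.2 hY hYd⟩) ⟨?_, ?_, ?_⟩
    ⟨hm.empty, fun a ha => hm.singleton a ha.1, fun X hX => hm.eq_integral X hX.1⟩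
    X hX𝒳 ⟨hX𝒳, hX⟩ hX.1
  · exact hν.empty σ (hsub hX (Set.empty_subset _) (DefPred.false (T := Tuple M σ)))
  · exact fun a ha => hν.singleton σ a ha.2
  · intro X hX hXd τ hτ f hf hfX
    have hbox := H.box_mem hτ
    have hbox' := defClass_subset_fiberableClass H.nonempty H.zeroDefinable τ hbox
    rw [hν.eq_finsum (fun h => h.1) hsub hX.2 hbox' hf hfX]
    refine finsum_congr fun c => ?_
    rw [hμ τ _ (subset_mem hbox (fun b hb => hb.1)
      (hν.definable_level (fun h => h.1) hX.2 hbox' hf hfX c))]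

end StableFubini

end Extension

end ManySorted

theorem mainTheorem7 {S : Type u} (L : MSLanguage.{u, v, v'} S)
    (M : S → Type w) [LStructure L M] (S₀ : Set S) (C : ∀ s, Set (M s))
    (hC_nonempty : ∀ s ∈ S₀, (C s).Nonempty)
    (hC_definable : ∀ s ∈ S₀, ZeroDefinable L {a : Tuple M [s] | a.1 ∈ C s})
    (hC_nontrivial : ∃ s ∈ S₀, (C s).Nontrivial)
    (hC_stable : StablyEmbedded L S₀ C)
    {A : Type x} [CommSemiring A] (μ : ∀ σ : List S, Set (Tuple M σ) → A)
    (hμ : IsFubiniMeasure L (defClass L S₀ C) μ) :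
    IsClosedClass L (fiberableClass L S₀ C) ∧
    (∀ σ, defClass L S₀ C σ ⊆ fiberableClass L S₀ C σ) ∧
    (∃ ν : ∀ σ : List S, Set (Tuple M σ) → A,
      IsFubiniMeasure L (fiberableClass L S₀ C) ν ∧
      (∀ σ, ∀ X ∈ defClass L S₀ C σ, ν σ X = μ σ X) ∧
      ∀ ν' : ∀ σ : List S, Set (Tuple M σ) → A,
        IsFubiniMeasure L (fiberableClass L S₀ C) ν' →
        (∀ σ, ∀ X ∈ defClass L S₀ C σ, ν' σ X = μ σ X) →
        ∀ σ, ∀ X ∈ fiberableClass L S₀ C σ, ν' σ X = ν σ X) := by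
  have H : StableFubini L S₀ C μ := ⟨hC_nonempty, hC_definable, hC_stable, hμ⟩
  exact ⟨isClosedClass_fiberableClass hC_nonempty hC_definable hC_nontrivial,
    defClass_subset_fiberableClass hC_nonempty hC_definable, StableFubini.extension L S₀ C μ,
    H.isFubiniMeasure_extension hC_nontrivial, fun _ _ hX => H.extension_eq_of_mem_defClass hX,
    fun _ hν hν' _ _ hX => H.extension_unique hC_nontrivial hν hν' hX⟩
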